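/- Let $G$ be a finite group with $m=|G|$ elements. Let $\mathbb Z_+G$ be the semiring of formal sums $\sum_g n_g g$ with nonnegative integer coefficients, contained in the group ring $\mathbb ZG$. For $\mathcal S=\mathbb Z_+G$ or $\mathcal S=\mathbb ZG$, square matrices $A,B$ over $\mathcal S$, possibly of different sizes, are *elementary strong shift equivalent* (ESSE) over $\mathcal S$ if $A=UV$, $B=VU$ for some matrices $U,V$ over $\mathcal S$, and *shift equivalent* (SE) over $\mathcal S$ if there are $\ell\ge 1$ and matrices $U,V$ over $\mathcal S$ with $A^\ell=UV$, $B^\ell=VU$, $AU=UB$, $BV=VA$. A square matrix $A$ over $\mathbb Z_+G$ is the adjacency matrix of a finite labeled directed graph: if $A(i,j)=\sum_g n_g g$, there are exactly $n_g$ edges from $i$ to $j$ with label $g$. Let $X_A$ be the space of bi-infinite edge paths $x=(x_k)_{k\in\mathbb Z}$ of this graph, $\sigma$ the shift on $X_A$, and $\tau_A(x)$ the label of the edge $x_0$. The $G$-SFT defined by $A$ is the homeomorphism $T_A:(x,h)\mapsto(\sigma x,h\,\tau_A(x))$ of $X_A\times G$ together with the left $G$-action $g\cdot(x,h)=(x,gh)$.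 Two homeomorphisms $T_1,T_2$ of spaces with a $G$-action are $G$-conjugate if some $G$-equivariant homeomorphism $\varphi$ satisfies $\varphi T_1=T_2\varphi$; they are *eventually conjugate* if $T_1^n$ and $T_2^n$ are $G$-conjugate for all but finitely many $n>0$. **(a)** For square matrices $A,B$ over $\mathbb Z_+G$, the $G$-SFTs $T_A,T_B$ are eventually conjugate if and only if $A,B$ are SE over $\mathbb Z_+G$. **(b)** Let $\mathcal S=\mathbb Z_+G$ or $\mathcal S=\mathbb ZG$, let $A$ be $n_1\times n_1$ and $B$ be $n_2\times n_2$ over $\mathcal S$, and let $n=\max\{n_1,n_2\}$. The following are equivalent: 1. $A$ and $B$ are SE over $\mathcal S$; 2. $A^r$ and $B^r$ are ESSE over $\mathcal S$ for all large $r$; 3. $A^r$ and $B^r$ are SE over $\mathcal S$ for all large $r$; 4. there is $k\ge 1$ with $k\equiv 1 \bmod ((mn)^2)!$ such that $A^k$ and $B^k$ are SE over $\mathcal S$; except that, when $\mathcal S=\mathbb ZG$ and $mn=1$, only the equivalence of 1, 2 and 3 is claimed. -/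

import Mathlib

namespace GSFT

/-! ### Shift equivalence of matrices over a semiring -/

section Matrices

variable {S : Type*} [Semiring S] {ι κ : Type*} [Fintype ι] [DecidableEq ι]
  [Fintype κ] [DecidableEq κ]

/-- Square matrices `A`, `B` (possibly of different sizes) are elementary strong shift equivalent
(ESSE) over `S`: there are matrices `U`, `V` over `S` with `A = UV` and `B = VU`. -/
def ESSE (A : Matrix ι ι S) (B : Matrix κ κ S) : Prop :=
  ∃ (U : Matrix ι κ S) (V : Matrix κ ι S), A = U * V ∧ B = V * U

/-- Square matrices `A`, `B` (possibly of different sizes) are shift equivalent (SE) over `S`: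
there are a lag `ℓ ≥ 1` and matrices `U`, `V` over `S` with `A ^ ℓ = UV`, `B ^ ℓ = VU`,
`AU = UB` and `BV = VA`. -/
def SE (A : Matrix ι ι S) (B : Matrix κ κ S) : Prop :=
  ∃ ℓ : ℕ, 1 ≤ ℓ ∧ ∃ (U : Matrix ι κ S) (V : Matrix κ ι S),
    A ^ ℓ = U * V ∧ B ^ ℓ = V * U ∧ A * U = U * B ∧ B * V = V * A

end Matrices

/-! ### Skew products and conjugacy of group extensions -/

section SkewProducts

/-- The space `X × G` of a skew product, with the product topology and the left `G`-action
`g • (x, h) = (x, g * h)`. (A type of its own, since `X × G` has no such action in Mathlib.) -/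
def ExtSpace (X G : Type*) := X × G

variable {X G : Type*} [TopologicalSpace X] [TopologicalSpace G] [Group G]

instance ExtSpace.instTopologicalSpace : TopologicalSpace (ExtSpace X G) :=
  inferInstanceAs (TopologicalSpace (X × G))

instance ExtSpace.instMulAction : MulAction G (ExtSpace X G) where
  smul g y := (y.1, g * y.2)
  one_smul y := Prod.ext rfl (one_mul y.2)
  mul_smul g h y := Prod.ext rfl (mul_assoc g h y.2)

/-- The group extension `(x, h) ↦ (S x, h * τ x)` of the homeomorphism `S` of `X` defined by the
skewing function `τ : X → G`. -/
def skewProduct [DiscreteTopology G] (S : X ≃ₜ X) (τ : C(X, G)) :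
    ExtSpace X G ≃ₜ ExtSpace X G where
  toFun y := (S y.1, y.2 * τ y.1)
  invFun y := (S.symm y.1, y.2 * (τ (S.symm y.1))⁻¹)
  left_inv y := by
    refine Prod.ext ?_ ?_
    · simp
    · simp
  right_inv y := by
    refine Prod.ext ?_ ?_
    · simp
    · simp
  continuous_toFun := by
    have h : Continuous fun y : X × G => (S y.1, y.2 * τ y.1) := by fun_prop
    exact h
  continuous_invFun := by
    have h : Continuous fun y : X × G => (S.symm y.1, y.2 * (τ (S.symm y.1))⁻¹) := by fun_prop
    exact h

/-- Two homeomorphisms of spaces with `G`-action are `G`-conjugate: there is a `G`-equivariant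
homeomorphism `φ` with `φ ∘ T₁ = T₂ ∘ φ`. -/
def GConjugate (G : Type*) [Group G] {Y₁ Y₂ : Type*} [TopologicalSpace Y₁] [TopologicalSpace Y₂]
    [MulAction G Y₁] [MulAction G Y₂] (T₁ : Y₁ ≃ₜ Y₁) (T₂ : Y₂ ≃ₜ Y₂) : Prop :=
  ∃ φ : Y₁ ≃ₜ Y₂, (∀ y, φ (T₁ y) = T₂ (φ y)) ∧ ∀ (g : G) (y : Y₁), φ (g • y) = g • φ y

/-- Eventual conjugacy: for all but finitely many `n > 0`, the `n`-th powers (iterates) are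
`G`-conjugate. -/
def EventuallyGConjugate (G : Type*) [Group G] {Y₁ Y₂ : Type*} [TopologicalSpace Y₁]
    [TopologicalSpace Y₂] [MulAction G Y₁] [MulAction G Y₂]
    (T₁ : Y₁ ≃ₜ Y₁) (T₂ : Y₂ ≃ₜ Y₂) : Prop :=
  {n : ℕ | 0 < n ∧ ¬ GConjugate G (T₁ ^ n) (T₂ ^ n)}.Finite

end SkewProducts

/-! ### The `G`-SFT of a square matrix over `ℤ₊G`

`ℤ₊G`, the semiring of formal sums `∑ n_g g` with nonnegative integer coefficients, is
`MonoidAlgebra ℕ G`. -/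

section EdgeShift

variable {G : Type*} [Group G] {ι : Type*}

/-- The edges of the labeled directed graph with vertex set `ι` and adjacency matrix `A`: if
`A i j = ∑ n_g g`, there are exactly `n_g` edges from `i` to `j` with label `g`. -/
structure Edge (A : Matrix ι ι (MonoidAlgebra ℕ G)) where
  /-- the initial vertex -/
  src : ι
  /-- the terminal vertex -/
  tgt : ι
  /-- the label -/
  label : G
  /-- the number of the edge among those with the same vertices and label -/
  idx : Fin ((A src tgt).coeff label)

/-- The set of edges is discrete. -/
instance Edge.instTopologicalSpace (A : Matrix ι ι (MonoidAlgebra ℕ G)) :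
    TopologicalSpace (Edge A) := ⊥

instance Edge.instDiscreteTopology (A : Matrix ι ι (MonoidAlgebra ℕ G)) :
    DiscreteTopology (Edge A) := ⟨rfl⟩

/-- The edge SFT: all bi-infinite edge paths, as a subspace of the product space `ℤ → Edge A`. -/
def EdgeShift (A : Matrix ι ι (MonoidAlgebra ℕ G)) :=
  {x : ℤ → Edge A // ∀ k, (x k).tgt = (x (k + 1)).src}

instance EdgeShift.instTopologicalSpace (A : Matrix ι ι (MonoidAlgebra ℕ G)) :
    TopologicalSpace (EdgeShift A) :=
  inferInstanceAs (TopologicalSpace {x : ℤ → Edge A // ∀ k, (x k).tgt = (x (k + 1)).src})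

/-- The shift homeomorphism `(σ x)_k = x_{k+1}`. -/
def shift (A : Matrix ι ι (MonoidAlgebra ℕ G)) : EdgeShift A ≃ₜ EdgeShift A where
  toFun x := ⟨fun k => x.1 (k + 1), fun k => x.2 (k + 1)⟩
  invFun x := ⟨fun k => x.1 (k - 1), fun k => by
    have h := x.2 (k - 1)
    rwa [show k - 1 + 1 = k + 1 - 1 by ring] at h⟩
  left_inv x := Subtype.ext (funext fun k => by simp)
  right_inv x := Subtype.ext (funext fun k => by simp)
  continuous_toFun := by
    refine Continuous.subtype_mk (continuous_pi fun k => ?_) _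
    exact (continuous_apply (k + 1)).comp continuous_subtype_val
  continuous_invFun := by
    refine Continuous.subtype_mk (continuous_pi fun k => ?_) _
    exact (continuous_apply (k - 1)).comp continuous_subtype_val

variable [TopologicalSpace G]

/-- The skewing function `τ_A`: the label of the edge `x₀`. -/
def skewing (A : Matrix ι ι (MonoidAlgebra ℕ G)) : C(EdgeShift A, G) where
  toFun x := (x.1 0).label
  continuous_toFun := by
    have h : Continuous fun e : Edge A => e.label := continuous_of_discreteTopology
    exact h.comp ((continuous_apply (0 : ℤ)).comp continuous_subtype_val)

/-- The `G`-SFT defined by the matrix `A` over `ℤ₊G`: the extension of the edge SFT of `A` by the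
skewing function `τ_A`, that is `(x, h) ↦ (σ x, h * label x₀)`, with the left action of `G`. -/
def extension [DiscreteTopology G] (A : Matrix ι ι (MonoidAlgebra ℕ G)) :
    ExtSpace (EdgeShift A) G ≃ₜ ExtSpace (EdgeShift A) G :=
  skewProduct (shift A) (skewing A)

end EdgeShift

end GSFT

/-!
Shift equivalence is compared with shift equivalence of powers and with conjugacy of powers of the
dynamical systems.

*Powers of matrices.* Matrices over `R[G]` are turned into ordinary matrices over `R`, indexed by
`ι × G`, by `GSFT.lift`; this is multiplicative and injective. Let `N` bound the sizes of the
resulting matrices. If `A ^ k * U = U * B ^ k`, then `X = A * U - U * B` satisfies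
`∑ A ^ i * X * B ^ (k - 1 - i) = 0`. If the left multiplication by `A` had a nonzero eigenvalue on
the space of all such `X`, it would have there a common eigenvector with the right multiplication by
`B`, so that `∑ x ^ i * y ^ (k - 1 - i) = 0` for eigenvalues `x ≠ 0` of `A` and `y` of `B`. For
`k ≡ 1 mod (N ^ 2)!` and `N ≠ 1` this is impossible (`GSFT.geom_sum_ne_zero_of_modEq`): `x / y`
would be a nontrivial root of unity whose order has only prime factors `p > N ^ 2`, while `x`, `y`
have degree at most `N`. The borderline case `p = N ^ 2 + 1` is excluded because the `p`-th
cyclotomic field is cyclic over `ℚ`, hence not the compositum of two fields of degree `N ≠ 1`. If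
`N = 1`, the sum can vanish for integers `x = -y`, but not for natural numbers. So `A` is nilpotent
on these `X`, that is, `A ^ M * U` intertwines `A` and `B` for large `M`, and
`GSFT.SE.of_pow_of_eventually` yields a shift equivalence of `A` and `B`. No positivity is lost,
since `A ^ M * U` has coefficients in the same semiring as `A` and `U`.

*From shift equivalence to conjugacy.* If `A ^ r = U * V` and `B ^ r = V * U`, the blocks of `r`
edges of a path over `A` are encoded by pairs `(u_q, v_q)`, and the pairs `(v_q, u_{q+1})` are
decoded to a path over `B`. This block map and the one defined in the same way from `B` to `A`
compose to the `r`-th powers of the two extensions (`GSFT.transfer_transfer`), so they are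
conjugacies of these powers.

*From conjugacy to shift equivalence.* A conjugacy of `n`-th powers puts on one space `Y` two
codings by bi-infinite paths, over `A` and over `B`, each of which determines the other within a
bounded window. For each coding and each time `m` there is the relation of having the same past
before `m`. The matrix `U` counts the classes of the past before `b` in the `B`-coding within a
class of the past before `0` in the `A`-coding, and `V` is defined in the same way with `A` and `B`
exchanged. That such a count depends only on the state of the class is seen by exchanging pasts
(`GSFT.Coding.past_of_glue`). As the classes of the past before `n` within a class of the past
before `0` in the `A`-coding are counted by `A ^ n`, the relations of a shift equivalence between
`A ^ n` and `B ^ n` express that a count can be made in two stages in different ways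
(`GSFT.Counts.mul`, `GSFT.Counts.unique`). This is true literally only if all vertices lie on
bi-infinite paths; in general `A` is replaced by its `GSFT.core`, to which it is shift equivalent
(`GSFT.se_core`).
-/

namespace GSFT

/-! ### Roots of integer polynomials whose ratio is a root of unity -/

section RootsOfUnity

open Polynomial IntermediateField

/-- A number of degree at most `N` generates a field of degree at most `N`. -/
theorem finrank_adjoin_le_of_isRoot {p : ℤ[X]} (hp : p.Monic) {x : ℂ}
    (hx : (p.map (algebraMap ℤ ℂ)).IsRoot x) :
    IsIntegral ℚ x ∧ Module.finrank ℚ ℚ⟮x⟯ ≤ p.natDegree := by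
  have hq : (p.map (algebraMap ℤ ℚ)).Monic := hp.map _
  have hx' : aeval x (p.map (algebraMap ℤ ℚ)) = 0 := by
    rw [aeval_map_algebraMap, aeval_def, ← eval_map]
    exact hx
  have hint : IsIntegral ℚ x := ⟨_, hq, by rwa [← aeval_def]⟩
  refine ⟨hint, ?_⟩
  rw [adjoin.finrank hint]
  calc (minpoly ℚ x).natDegree ≤ (p.map (algebraMap ℤ ℚ)).natDegree :=
        natDegree_le_of_dvd (minpoly.dvd ℚ x hx') hq.ne_zero
    _ = p.natDegree := hp.natDegree_map _

/-- A cyclic extension of degree `N ^ 2`, `N ≠ 1`, is not generated by two subextensions of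
degree `N`: the `N`-th power of a generator of the Galois group fixes both of them. -/
theorem sup_ne_top_of_isCyclic {K L : Type*} [Field K] [Field L] [Algebra K L]
    [FiniteDimensional K L] [IsGalois K L] [IsCyclic Gal(L/K)] {N : ℕ} (hN : N ≠ 1)
    (hL : Module.finrank K L = N * N) {E F : IntermediateField K L}
    (hE : Module.finrank K E = N) (hF : Module.finrank K F = N) : E ⊔ F ≠ ⊤ := by
  intro htop
  obtain ⟨s, hs⟩ := IsCyclic.exists_generator (α := Gal(L/K))
  have hcard : Nat.card Gal(L/K) = N * N := by
    rw [IsGalois.card_aut_eq_finrank, hL]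
  have hN0 : 0 < N := by
    rw [← hE]; exact Module.finrank_pos
  have key : ∀ M : IntermediateField K L, Module.finrank K M = N → s ^ N ∈ M.fixingSubgroup := by
    intro M hM
    have h1 : Nat.card M.fixingSubgroup = N := by
      rw [IsGalois.card_fixingSubgroup_eq_finrank]
      have := Module.finrank_mul_finrank K M L
      rw [hM, hL] at this
      exact Nat.eq_of_mul_eq_mul_left hN0 this
    have h2 : M.fixingSubgroup.index = N := by
      have := M.fixingSubgroup.card_mul_index
      rw [h1, hcard] at this
      exact Nat.eq_of_mul_eq_mul_left hN0 this
    have hnorm : M.fixingSubgroup.Normal := by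
      let := IsCyclic.commGroup (α := Gal(L/K))
      exact ⟨fun a ha g => by
        have hcomm : g * a = a * g := mul_comm g a
        rw [hcomm, mul_inv_cancel_right]; exact ha⟩
    have := M.fixingSubgroup.pow_index_mem s
    rwa [h2] at this
  have h3 : s ^ N ∈ (E ⊔ F).fixingSubgroup := by
    rw [IntermediateField.fixingSubgroup_sup]
    exact ⟨key E hE, key F hF⟩
  rw [htop, IntermediateField.fixingSubgroup_top, Subgroup.mem_bot] at h3
  have h4 : orderOf s = N * N := by
    rw [orderOf_eq_card_of_forall_mem_zpowers hs, hcard]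
  have h5 : N * N ∣ N := h4 ▸ orderOf_dvd_of_pow_eq_one h3
  have h6 := Nat.le_of_dvd hN0 h5
  have : N ≤ 1 := by nlinarith
  omega

/-- If `x` and `y` have degree at most `N ≠ 1` over `K`, then `K(x, y)` contains no primitive `p`-th
root of unity for a prime `p > N ^ 2` with irreducible cyclotomic polynomial. The only delicate case
is `p = N ^ 2 + 1`, in which `K(x, y)` would be the whole `p`-th cyclotomic field. -/
theorem not_mem_sup_of_isPrimitiveRoot {K E : Type*} [Field K] [Field E] [Algebra K E]
    [CharZero K] {N : ℕ} (hN : N ≠ 1) {x y z : E} {p : ℕ} (hp : p.Prime)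
    (hirr : Irreducible (cyclotomic p K))
    (hpN : N * N < p) (hz : IsPrimitiveRoot z p) (hxi : IsIntegral K x) (hyi : IsIntegral K y)
    (hx : Module.finrank K K⟮x⟯ ≤ N) (hy : Module.finrank K K⟮y⟯ ≤ N) : z ∉ K⟮x⟯ ⊔ K⟮y⟯ := by
  intro hmem
  have := adjoin.finiteDimensional hxi
  have := adjoin.finiteDimensional hyi
  have : Fact p.Prime := ⟨hp⟩
  have hle : K⟮z⟯ ≤ K⟮x⟯ ⊔ K⟮y⟯ := by
    rw [adjoin_simple_le_iff]; exact hmem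
  have hzi : IsIntegral K z := (hz.isIntegral hp.pos).tower_top
  have hdeg : Module.finrank K K⟮z⟯ = p - 1 := by
    rw [adjoin.finrank hzi, ← hz.minpoly_eq_cyclotomic_of_irreducible hirr, natDegree_cyclotomic,
      Nat.totient_prime hp]
  have h1 : Module.finrank K K⟮z⟯ ≤ Module.finrank K ↥(K⟮x⟯ ⊔ K⟮y⟯) :=
    LinearMap.finrank_le_finrank_of_injective (f := (inclusion hle).toLinearMap)
      (inclusion hle).injective
  have h2 := finrank_sup_le K⟮x⟯ K⟮y⟯
  set a := Module.finrank K K⟮x⟯ with ha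
  set b := Module.finrank K K⟮y⟯ with hb
  have hab : a * b ≤ N * N := Nat.mul_le_mul hx hy
  have ha0 : 0 < a := Module.finrank_pos
  have hb0 : 0 < b := Module.finrank_pos
  have haN : a = N := by
    by_contra h
    have : a < N := by omega
    have : a * b < N * N := by nlinarith
    omega
  have hbN : b = N := by
    by_contra h
    have : b < N := by omega
    have : a * b < N * N := by nlinarith
    omega
  have heq : K⟮z⟯ = K⟮x⟯ ⊔ K⟮y⟯ := eq_of_le_of_finrank_le hle (by omega)
  have : FiniteDimensional K K⟮z⟯ := adjoin.finiteDimensional hzi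
  have : IsCyclotomicExtension {p} K K⟮z⟯ :=
    (IntermediateField.isCyclotomicExtension_singleton_iff_eq_adjoin _ _ _ K⟮z⟯ hz).mpr rfl
  have : IsGalois K K⟮z⟯ := IsCyclotomicExtension.isGalois {p} K _
  have : IsCyclic Gal(K⟮z⟯/K) :=
    isCyclic_of_injective (IsCyclotomicExtension.autEquivPow K⟮z⟯ hirr).toMonoidHom
      (IsCyclotomicExtension.autEquivPow K⟮z⟯ hirr).injective
  have hxz : K⟮x⟯ ≤ K⟮z⟯ := heq ▸ le_sup_left
  have hyz : K⟮y⟯ ≤ K⟮z⟯ := heq ▸ le_sup_right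
  have hrank : ∀ M : IntermediateField K E, ∀ h : M ≤ K⟮z⟯,
      Module.finrank K (restrict h) = Module.finrank K M := fun M h =>
    (restrictAlgEquiv h).toLinearEquiv.finrank_eq.symm
  refine sup_ne_top_of_isCyclic (K := K) (L := K⟮z⟯) hN (by omega) (E := restrict hxz)
    (F := restrict hyz) (by rw [hrank, ← ha, haN]) (by rw [hrank, ← hb, hbN]) ?_
  apply lift_injective
  rw [lift_sup, lift_restrict, lift_restrict, lift_top, heq]

/-- The arithmetic of the exponents `k ≡ 1 mod (N ^ 2)!`: if `x ≠ 0` and `y` are of degree at most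
`N ≠ 1`, then `(x ^ k - y ^ k) / (x - y)`, written as a sum, does not vanish. Otherwise `x / y` is
a nontrivial `k`-th root of unity, and all prime factors of `k` exceed `N ^ 2`. -/
theorem geom_sum_ne_zero_of_modEq {N : ℕ} (hN : N ≠ 1) {x y : ℂ} {k : ℕ} (hk1 : 1 ≤ k)
    (hk : k ≡ 1 [MOD (N ^ 2).factorial]) (hxi : IsIntegral ℚ x) (hyi : IsIntegral ℚ y)
    (hx : Module.finrank ℚ ℚ⟮x⟯ ≤ N) (hy : Module.finrank ℚ ℚ⟮y⟯ ≤ N) (hx0 : x ≠ 0) :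
    ∑ i ∈ Finset.range k, x ^ i * y ^ (k - 1 - i) ≠ 0 := by
  intro hsum
  have hpow : x ^ k = y ^ k := by
    have := geom_sum₂_mul x y k
    rw [hsum, zero_mul] at this
    exact (sub_eq_zero.mp this.symm)
  have hy0 : y ≠ 0 := by
    rintro rfl
    rw [zero_pow (by omega)] at hpow
    exact hx0 (pow_eq_zero_iff (by omega) |>.mp hpow)
  by_cases hxy : x = y
  · subst hxy
    have : ∑ i ∈ Finset.range k, x ^ i * x ^ (k - 1 - i) = k * x ^ (k - 1) := by
      rw [Finset.sum_congr rfl (g := fun _ => x ^ (k - 1))]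
      · simp
      · intro i hi
        rw [Finset.mem_range] at hi
        rw [← pow_add]; congr 1; omega
    rw [this] at hsum
    have hk0 : (k : ℂ) ≠ 0 := by exact_mod_cast (by omega : k ≠ 0)
    exact mul_ne_zero hk0 (pow_ne_zero _ hx0) hsum
  · have hr : (x / y) ^ k = 1 := by
      rw [div_pow, hpow, div_self (pow_ne_zero _ hy0)]
    have hr1 : x / y ≠ 1 := fun h => hxy ((div_eq_one_iff_eq hy0).mp h)
    set q := orderOf (x / y) with hq
    have hqk : q ∣ k := orderOf_dvd_of_pow_eq_one hr
    have hq1 : q ≠ 1 := by rwa [hq, Ne, orderOf_eq_one_iff]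
    have hq0 : q ≠ 0 := fun h => by rw [h, zero_dvd_iff] at hqk; omega
    obtain ⟨p, hp, hpq⟩ := Nat.exists_prime_and_dvd hq1
    have hpN : N * N < p := by
      by_contra hle
      have h1 : p ∣ (N ^ 2).factorial := by
        rw [hp.dvd_factorial, sq]; omega
      have h2 : k ≡ 1 [MOD p] := hk.of_dvd h1
      have h3 : k ≡ 0 [MOD p] := (Nat.modEq_zero_iff_dvd).mpr (hpq.trans hqk)
      have h4 : p ∣ 1 := (Nat.modEq_zero_iff_dvd).mp (h2.symm.trans h3)
      exact hp.one_lt.ne' (Nat.dvd_one.mp h4)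
    have hprim : IsPrimitiveRoot ((x / y) ^ (q / p)) p := by
      have := (IsPrimitiveRoot.orderOf (x / y)).pow (Nat.pos_of_ne_zero hq0)
        (show orderOf (x / y) = (q / p) * p by rw [← hq, Nat.div_mul_cancel hpq])
      exact this
    refine not_mem_sup_of_isPrimitiveRoot hN hp (cyclotomic.irreducible_rat hp.pos) hpN hprim
      hxi hyi hx hy ?_
    refine pow_mem (div_mem ?_ ?_) _
    · exact (le_sup_left : ℚ⟮x⟯ ≤ _) (mem_adjoin_simple_self ℚ x)
    · exact (le_sup_right : ℚ⟮y⟯ ≤ _) (mem_adjoin_simple_self ℚ y)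

end RootsOfUnity

/-! ### Intertwining of powers -/

section Intertwining

open Polynomial

/-- If commuting endomorphisms `L`, `R` of a finite-dimensional complex space have no pair of
eigenvalues `(a, b)`, `a ≠ 0`, with `∑ a ^ i * b ^ (k - 1 - i) = 0`, then `L ^ k v = R ^ k v` implies
`L v = R v` up to a power of `L`. Indeed `L v - R v` lies in the kernel of
`∑ L ^ i * R ^ (k - 1 - i)`, on which `L` is nilpotent because `L` and `R` have a common eigenvector
there for each eigenvalue of `L`. -/
theorem exists_pow_apply_sub_eq_zero {V : Type*} [AddCommGroup V] [Module ℂ V]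
    [FiniteDimensional ℂ V] {L R : Module.End ℂ V} (hLR : Commute L R) {k : ℕ}
    (hev : ∀ a b : ℂ, a ≠ 0 → L.HasEigenvalue a → R.HasEigenvalue b →
      ∑ i ∈ Finset.range k, a ^ i * b ^ (k - 1 - i) ≠ 0)
    {v : V} (hv : (L ^ k) v = (R ^ k) v) : ∃ M : ℕ, (L ^ M) (L v - R v) = 0 := by
  set P : Module.End ℂ V := ∑ i ∈ Finset.range k, L ^ i * R ^ (k - 1 - i) with hP
  have hPL : Commute P L := Commute.sum_left _ _ _ fun i _ =>
    ((Commute.refl L).pow_left i).mul_left (hLR.symm.pow_left _)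
  have hPR : Commute P R := Commute.sum_left _ _ _ fun i _ =>
    (hLR.pow_left i).mul_left ((Commute.refl R).pow_left _)
  have hPw : P (L v - R v) = 0 := by
    have h := hLR.geom_sum₂_mul k
    have h2 := congrArg (fun f : Module.End ℂ V => f v) h
    simpa [hP, hv] using h2
  have hmaps : ∀ x ∈ P.ker, L x ∈ P.ker := fun x hx => by
    rw [LinearMap.mem_ker] at hx ⊢
    rw [← Module.End.mul_apply, hPL.eq, Module.End.mul_apply, hx, map_zero]
  set f : Module.End ℂ P.ker := L.restrict hmaps with hf
  -- a nonzero eigenvalue of `f` would give a common eigenvector of `L` and `R` in `ker P`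
  have hno : ∀ a : ℂ, a ≠ 0 → ¬ f.HasEigenvalue a := by
    intro a ha hfa
    obtain ⟨x, hx⟩ := hfa.exists_hasEigenvector
    have hxL : L x = a • (x : V) := congrArg Subtype.val hx.apply_eq_smul
    set W : Submodule ℂ V := P.ker ⊓ Module.End.eigenspace L a with hW
    have hxW : (x : V) ∈ W := ⟨x.2, Module.End.mem_eigenspace_iff.mpr hxL⟩
    have hx0 : (x : V) ≠ 0 := fun h => hx.2 (Subtype.ext h)
    have : Nontrivial W := ⟨⟨⟨x, hxW⟩, 0, fun h => hx0 (congrArg Subtype.val h)⟩⟩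
    have hRW : ∀ y ∈ W, R y ∈ W := by
      rintro y ⟨hy1, hy2⟩
      refine ⟨?_, ?_⟩
      · rw [SetLike.mem_coe, LinearMap.mem_ker] at hy1 ⊢
        rw [← Module.End.mul_apply, hPR.eq, Module.End.mul_apply, hy1, map_zero]
      · rw [SetLike.mem_coe, Module.End.mem_eigenspace_iff] at hy2 ⊢
        rw [← Module.End.mul_apply, hLR.eq, Module.End.mul_apply, hy2, map_smul]
    obtain ⟨b, hb⟩ := Module.End.exists_eigenvalue (R.restrict hRW)
    obtain ⟨y, hy⟩ := hb.exists_hasEigenvector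
    have hyR : R y = b • (y : V) := congrArg Subtype.val hy.apply_eq_smul
    have hy0 : (y : V) ≠ 0 := fun h => hy.2 (Subtype.ext h)
    have hyL : L.HasEigenvector a y := ⟨y.2.2, hy0⟩
    have hyR' : R.HasEigenvector b y := ⟨Module.End.mem_eigenspace_iff.mpr hyR, hy0⟩
    refine hev a b ha (Module.End.hasEigenvalue_of_hasEigenvector hyL)
      (Module.End.hasEigenvalue_of_hasEigenvector hyR') ?_
    have hPy : P y = (∑ i ∈ Finset.range k, a ^ i * b ^ (k - 1 - i)) • (y : V) := by
      rw [hP, LinearMap.sum_apply, Finset.sum_smul]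
      refine Finset.sum_congr rfl fun i _ => ?_
      rw [Module.End.mul_apply, hyR'.pow_apply, map_smul, hyL.pow_apply, smul_smul, mul_comm]
    have h0 : P y = 0 := y.2.1
    rw [h0] at hPy
    exact (smul_eq_zero.mp hPy.symm).resolve_right hy0
  have htop := Module.End.iSup_maxGenEigenspace_eq_top f
  have hbot : ∀ a : ℂ, a ≠ 0 → f.maxGenEigenspace a = ⊥ := by
    intro a ha
    by_contra hne
    obtain ⟨x, hx, hx0⟩ := Submodule.exists_mem_ne_zero_of_ne_bot hne
    obtain ⟨m, hm⟩ := (Module.End.mem_maxGenEigenspace f a x).mp hx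
    refine hno a ha (Module.End.hasEigenvalue_of_hasGenEigenvalue (k := m) ?_)
    intro hbot
    have : x ∈ f.genEigenspace a m := by
      rw [Module.End.mem_genEigenspace_nat, LinearMap.mem_ker]; exact hm
    rw [hbot] at this
    exact hx0 this
  have hzero : f.maxGenEigenspace 0 = ⊤ := by
    rw [eq_top_iff, ← htop]
    refine iSup_le fun a => ?_
    by_cases ha : a = 0
    · rw [ha]
    · rw [hbot a ha]; exact bot_le
  have hmem : (⟨L v - R v, hPw⟩ : P.ker) ∈ f.maxGenEigenspace 0 := hzero ▸ Submodule.mem_top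
  obtain ⟨M, hM⟩ := (Module.End.mem_maxGenEigenspace f 0 _).mp hmem
  refine ⟨M, ?_⟩
  rw [zero_smul, sub_zero, hf, Module.End.pow_restrict] at hM
  exact congrArg Subtype.val hM

theorem isUnit_det_scalar_sub {ι : Type*} [Fintype ι] [DecidableEq ι] {C : Matrix ι ι ℂ} {a : ℂ}
    (h : ¬ C.charpoly.IsRoot a) : IsUnit (Matrix.scalar ι a - C).det := by
  rw [IsRoot, Matrix.eval_charpoly] at h
  exact isUnit_iff_ne_zero.mpr h

/-- The matrix form of `exists_pow_apply_sub_eq_zero`. -/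
theorem exists_pow_mul_eq_of_pow_mul_eq {ι κ : Type*} [Fintype ι] [DecidableEq ι] [Fintype κ]
    [DecidableEq κ] {A : Matrix ι ι ℂ} {B : Matrix κ κ ℂ} {k : ℕ}
    (hev : ∀ a b : ℂ, a ≠ 0 → A.charpoly.IsRoot a → B.charpoly.IsRoot b →
      ∑ i ∈ Finset.range k, a ^ i * b ^ (k - 1 - i) ≠ 0)
    {U : Matrix ι κ ℂ} (hU : A ^ k * U = U * B ^ k) :
    ∃ M : ℕ, A ^ M * (A * U) = A ^ M * (U * B) := by
  set L : Module.End ℂ (Matrix ι κ ℂ) := mulLeftLinearMap κ ℂ A with hL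
  set R : Module.End ℂ (Matrix ι κ ℂ) := mulRightLinearMap ι ℂ B with hR
  have hLk : ∀ (n : ℕ) (X : Matrix ι κ ℂ), (L ^ n) X = A ^ n * X := by
    intro n X
    induction n with
    | zero => simp
    | succ n ih => rw [pow_succ', Module.End.mul_apply, ih, pow_succ', Matrix.mul_assoc]; rfl
  have hRk : ∀ (n : ℕ) (X : Matrix ι κ ℂ), (R ^ n) X = X * B ^ n := by
    intro n X
    induction n with
    | zero => simp
    | succ n ih => rw [pow_succ', Module.End.mul_apply, ih, pow_succ, ← Matrix.mul_assoc]; rfl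
  have hLR : Commute L R := commute_mulLeftLinearMap_mulRightLinearMap A B
  have hLe : ∀ a, L.HasEigenvalue a → A.charpoly.IsRoot a := by
    intro a ha
    obtain ⟨X, hX⟩ := ha.exists_hasEigenvector
    by_contra hn
    have h1 : (Matrix.scalar ι a - A) * X = 0 := by
      have h2 : A * X = a • X := hX.apply_eq_smul
      rw [Matrix.sub_mul, h2, sub_eq_zero]; ext; simp
    refine hX.2 ?_
    rw [← Matrix.nonsing_inv_mul_cancel_left _ X (isUnit_det_scalar_sub hn), h1, Matrix.mul_zero]
  have hRe : ∀ a, R.HasEigenvalue a → B.charpoly.IsRoot a := by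
    intro a ha
    obtain ⟨X, hX⟩ := ha.exists_hasEigenvector
    by_contra hn
    have h1 : X * (Matrix.scalar κ a - B) = 0 := by
      have h2 : X * B = a • X := hX.apply_eq_smul
      rw [Matrix.mul_sub, h2, sub_eq_zero]; ext; simp [mul_comm]
    refine hX.2 ?_
    rw [← Matrix.mul_nonsing_inv_cancel_right _ X (isUnit_det_scalar_sub hn), h1, Matrix.zero_mul]
  obtain ⟨M, hM⟩ := exists_pow_apply_sub_eq_zero hLR (k := k)
    (fun a b ha hLa hRb => hev a b ha (hLe a hLa) (hRe b hRb)) (v := U)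
    (by rw [hLk, hRk, hU])
  refine ⟨M, ?_⟩
  rw [map_sub, hLk, hLk, sub_eq_zero] at hM
  exact hM

end Intertwining

/-! ### Matrices over a group ring as invariant matrices -/

section Lift

variable {G : Type*} [Group G] {ι κ ν : Type*}

/-- The matrix over `R` indexed by `ι × G` and `κ × G` defined by a matrix `M` over `R[G]`: its
entry at `(i, g)`, `(j, h)` is the coefficient of `M i j` at `g⁻¹ * h`. For `M` over `ℕ[G]` it is the
adjacency matrix of the covering graph with vertices `ι × G`. -/
def lift {R : Type*} [Semiring R] (M : Matrix ι κ (MonoidAlgebra R G)) :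
    Matrix (ι × G) (κ × G) R :=
  Matrix.of fun p q => (M p.1 q.1).coeff (p.2⁻¹ * q.2)

variable {R : Type*} [Semiring R]

theorem lift_injective :
    Function.Injective (lift : Matrix ι κ (MonoidAlgebra R G) → Matrix (ι × G) (κ × G) R) := by
  intro M M' h
  ext i j g
  simpa [lift] using congrFun (congrFun h (i, 1)) (j, g)

theorem coeff_mul_eq_sum [Fintype G] (x y : MonoidAlgebra R G) (g : G) :
    (x * y).coeff g = ∑ h : G, x.coeff h * y.coeff (h⁻¹ * g) := by
  classical
  rw [MonoidAlgebra.coeff_mul_antidiag x y g (Finset.univ.image fun h : G => (h, h⁻¹ * g))]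
  · rw [Finset.sum_image]
    intro a _ b _ h
    exact congrArg Prod.fst h
  · rintro ⟨a, b⟩
    simp only [Finset.mem_image, Finset.mem_univ, true_and, Prod.mk.injEq]
    constructor
    · rintro ⟨h, rfl, rfl⟩
      simp
    · rintro rfl
      exact ⟨a, rfl, by simp⟩

theorem lift_mul [Fintype G] [Fintype κ] (M : Matrix ι κ (MonoidAlgebra R G))
    (P : Matrix κ ν (MonoidAlgebra R G)) : lift (M * P) = lift M * lift P := by
  ext ⟨i, g⟩ ⟨j, h⟩
  simp only [lift, Matrix.of_apply, Matrix.mul_apply, Fintype.sum_prod_type]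
  rw [MonoidAlgebra.coeff_sum, Finsupp.finsetSum_apply]
  refine Finset.sum_congr rfl fun l _ => ?_
  rw [coeff_mul_eq_sum]
  refine Fintype.sum_equiv (Equiv.mulLeft g) _ _ fun a => ?_
  simp [mul_assoc]

theorem lift_one [DecidableEq ι] [DecidableEq G] :
    lift (1 : Matrix ι ι (MonoidAlgebra R G)) = 1 := by
  ext ⟨i, g⟩ ⟨j, h⟩
  by_cases hij : i = j
  · subst hij
    by_cases hgh : g = h
    · subst hgh; simp [lift]
    · have : g⁻¹ * h ≠ 1 := fun e => hgh (inv_mul_eq_one.mp e)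
      simp [lift, hgh, MonoidAlgebra.one_def, this]
  · simp [lift, hij]

theorem lift_pow [Fintype G] [DecidableEq G] [Fintype ι] [DecidableEq ι]
    (M : Matrix ι ι (MonoidAlgebra R G)) (n : ℕ) : lift (M ^ n) = lift M ^ n := by
  induction n with
  | zero => simp [lift_one]
  | succ n ih => rw [pow_succ, pow_succ, lift_mul, ih]

end Lift

/-! ### Shift equivalence over a semiring -/

section ShiftEquivalence

variable {S : Type*} [Semiring S] {ι κ ν : Type*} [Fintype ι] [DecidableEq ι]
  [Fintype κ] [DecidableEq κ] [Fintype ν] [DecidableEq ν]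

theorem ESSE.se {A : Matrix ι ι S} {B : Matrix κ κ S} (h : ESSE A B) : SE A B := by
  obtain ⟨U, V, rfl, rfl⟩ := h
  exact ⟨1, le_rfl, U, V, pow_one _, pow_one _, Matrix.mul_assoc _ _ _, Matrix.mul_assoc _ _ _⟩

theorem SE.symm {A : Matrix ι ι S} {B : Matrix κ κ S} (h : SE A B) : SE B A := by
  obtain ⟨l, hl, U, V, h1, h2, h3, h4⟩ := h
  exact ⟨l, hl, V, U, h2, h1, h4, h3⟩

/-- A matrix intertwining `A` and `B` intertwines their powers. -/
theorem pow_mul_eq_mul_pow {A : Matrix ι ι S} {B : Matrix κ κ S} {U : Matrix ι κ S}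
    (h : A * U = U * B) (n : ℕ) : A ^ n * U = U * B ^ n := by
  induction n with
  | zero => simp
  | succ n ih => rw [pow_succ, Matrix.mul_assoc, h, ← Matrix.mul_assoc, ih, Matrix.mul_assoc,
      ← pow_succ]

theorem SE.trans {A : Matrix ι ι S} {B : Matrix κ κ S} {C : Matrix ν ν S} (h : SE A B)
    (h' : SE B C) : SE A C := by
  obtain ⟨l, hl, U, V, h1, h2, h3, h4⟩ := h
  obtain ⟨l', _, U', V', h1', h2', h3', h4'⟩ := h'
  refine ⟨l + l', by omega, U * U', V' * V, ?_, ?_, ?_, ?_⟩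
  · calc A ^ (l + l') = A ^ l' * (U * V) := by rw [← h1, ← pow_add, add_comm]
      _ = U * B ^ l' * V := by rw [← Matrix.mul_assoc, pow_mul_eq_mul_pow h3]
      _ = U * U' * (V' * V) := by rw [h1']; simp only [Matrix.mul_assoc]
  · calc C ^ (l + l') = C ^ l * (V' * U') := by rw [← h2', ← pow_add]
      _ = V' * B ^ l * U' := by rw [← Matrix.mul_assoc, pow_mul_eq_mul_pow h4']
      _ = V' * V * (U * U') := by rw [h2]; simp only [Matrix.mul_assoc]
  · rw [← Matrix.mul_assoc, h3, Matrix.mul_assoc, h3', Matrix.mul_assoc]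
  · rw [← Matrix.mul_assoc, h4', Matrix.mul_assoc, h4, Matrix.mul_assoc]

/-- All powers beyond the lag of a shift equivalence are elementary strong shift equivalent. -/
theorem SE.exists_forall_esse {A : Matrix ι ι S} {B : Matrix κ κ S} (h : SE A B) :
    ∃ N : ℕ, ∀ n ≥ N, ESSE (A ^ n) (B ^ n) := by
  obtain ⟨l, -, U, V, h1, h2, h3, -⟩ := h
  refine ⟨l, fun n hn => ⟨A ^ (n - l) * U, V, ?_, ?_⟩⟩
  · rw [Matrix.mul_assoc, ← h1, ← pow_add, Nat.sub_add_cancel hn]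
  · rw [pow_mul_eq_mul_pow h3, ← Matrix.mul_assoc, ← h2, ← pow_add, Nat.add_sub_cancel' hn]

/-- A shift equivalence of `A ^ k` and `B ^ k` given by `U`, `V` becomes one of `A` and `B` once
`U` and `V` intertwine `A` and `B` up to powers of `A` and `B`. -/
theorem SE.of_pow_of_eventually {A : Matrix ι ι S} {B : Matrix κ κ S} {k : ℕ} (hk : 1 ≤ k)
    (h : SE (A ^ k) (B ^ k))
    (hU : ∀ U : Matrix ι κ S, A ^ k * U = U * B ^ k → ∃ M, A ^ M * (A * U) = A ^ M * (U * B))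
    (hV : ∀ V : Matrix κ ι S, B ^ k * V = V * A ^ k → ∃ M, B ^ M * (B * V) = B ^ M * (V * A)) :
    SE A B := by
  obtain ⟨l, hl, U, V, h1, h2, h3, h4⟩ := h
  obtain ⟨a, ha⟩ := hU U h3
  obtain ⟨b, hb⟩ := hV V h4
  have hka : k * a = (k * a - a) + a :=
    (Nat.sub_add_cancel (Nat.le_mul_of_pos_left _ (by omega))).symm
  have hkb : k * b = (k * b - b) + b :=
    (Nat.sub_add_cancel (Nat.le_mul_of_pos_left _ (by omega))).symm
  have ha' : A ^ (k * a) * (A * U) = A ^ (k * a) * (U * B) := by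
    rw [hka, pow_add, Matrix.mul_assoc, ha, Matrix.mul_assoc]
  have hb' : B ^ (k * b) * (B * V) = B ^ (k * b) * (V * A) := by
    rw [hkb, pow_add, Matrix.mul_assoc, hb, Matrix.mul_assoc]
  have hUB : ∀ n, U * B ^ (k * n) = A ^ (k * n) * U := fun n => by
    rw [pow_mul, pow_mul, pow_mul_eq_mul_pow h3]
  have hVA : ∀ n, V * A ^ (k * n) = B ^ (k * n) * V := fun n => by
    rw [pow_mul, pow_mul, pow_mul_eq_mul_pow h4]
  refine ⟨k * (a + b + l), Nat.mul_pos (by omega) (by omega), A ^ (k * a) * U, B ^ (k * b) * V,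
    ?_, ?_, ?_, ?_⟩
  · calc A ^ (k * (a + b + l)) = A ^ (k * a) * (A ^ (k * b) * (U * V)) := by
          rw [← h1, ← pow_mul, ← pow_add, ← pow_add, mul_add, mul_add, add_assoc]
      _ = A ^ (k * a) * U * (B ^ (k * b) * V) := by
          rw [← Matrix.mul_assoc _ U V, ← hUB]; simp only [Matrix.mul_assoc]
  · calc B ^ (k * (a + b + l)) = B ^ (k * b) * (B ^ (k * a) * (V * U)) := by
          rw [← h2, ← pow_mul, ← pow_add, ← pow_add]; congr 1; ring
      _ = B ^ (k * b) * V * (A ^ (k * a) * U) := by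
          rw [← Matrix.mul_assoc _ V U, ← hVA]; simp only [Matrix.mul_assoc]
  · rw [← Matrix.mul_assoc, ← pow_succ', pow_succ, Matrix.mul_assoc, ha', Matrix.mul_assoc]
  · rw [← Matrix.mul_assoc, ← pow_succ', pow_succ, Matrix.mul_assoc, hb', Matrix.mul_assoc]

end ShiftEquivalence

/-! ### Shift equivalence of powers over a group ring -/

section GroupRing

variable {G : Type*} [Group G] {ι κ : Type*} [Fintype ι] [DecidableEq ι]
  [Fintype κ] [DecidableEq κ]

/-- The matrices `lift` carry `exists_pow_mul_eq_of_pow_mul_eq` over to matrices over a group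
ring. -/
theorem exists_pow_mul_eq_of_charpoly_lift [Fintype G] [DecidableEq G] {R : Type*} [Semiring R]
    {d : R →+* ℂ} (hd : Function.Injective d) {A : Matrix ι ι (MonoidAlgebra R G)}
    {B : Matrix κ κ (MonoidAlgebra R G)} {k : ℕ}
    (hev : ∀ x y : ℂ, x ≠ 0 → ((lift A).map d).charpoly.IsRoot x →
      ((lift B).map d).charpoly.IsRoot y → ∑ i ∈ Finset.range k, x ^ i * y ^ (k - 1 - i) ≠ 0)
    {U : Matrix ι κ (MonoidAlgebra R G)} (hU : A ^ k * U = U * B ^ k) :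
    ∃ M, A ^ M * (A * U) = A ^ M * (U * B) := by
  have hU' := congrArg (fun X => (lift X).map d) hU
  simp only [lift_mul, lift_pow, Matrix.map_mul, Matrix.map_pow] at hU'
  obtain ⟨M, hM⟩ := exists_pow_mul_eq_of_pow_mul_eq hev hU'
  refine ⟨M, lift_injective (Matrix.map_injective hd ?_)⟩
  simpa only [lift_mul, lift_pow, Matrix.map_mul, Matrix.map_pow] using hM

/-- Shift equivalence of `A ^ k` and `B ^ k` implies that of `A` and `B` if the integer matrices
`lift A`, `lift B` have no eigenvalues `x`, `y`, not both zero, with `(x ^ k - y ^ k) / (x - y) = 0`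
(written as a sum). -/
theorem SE.of_pow [Fintype G] [DecidableEq G] {R : Type*} [Semiring R] {c : R →+* ℤ}
    (hc : Function.Injective c)
    {A : Matrix ι ι (MonoidAlgebra R G)} {B : Matrix κ κ (MonoidAlgebra R G)} {k : ℕ} (hk : 1 ≤ k)
    (hev : ∀ x y : ℂ,
      (((lift A).map c).charpoly.map (algebraMap ℤ ℂ)).IsRoot x →
      (((lift B).map c).charpoly.map (algebraMap ℤ ℂ)).IsRoot y → x ≠ 0 ∨ y ≠ 0 →
      ∑ i ∈ Finset.range k, x ^ i * y ^ (k - 1 - i) ≠ 0)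
    (h : SE (A ^ k) (B ^ k)) : SE A B := by
  have hd : Function.Injective ((algebraMap ℤ ℂ).comp c) :=
    (algebraMap ℤ ℂ).injective_int.comp hc
  simp only [← Matrix.charpoly_map, Matrix.map_map] at hev
  refine h.of_pow_of_eventually hk (fun U hU => exists_pow_mul_eq_of_charpoly_lift hd ?_ hU)
    (fun V hV => exists_pow_mul_eq_of_charpoly_lift hd ?_ hV)
  · exact fun x y hx hxA hyB => hev x y hxA hyB (Or.inl hx)
  · intro y x hy hyB hxA
    rw [geom_sum₂_comm]
    exact hev x y hxA hyB (Or.inr hy)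

/-- For matrices of size at most `N ≠ 1` after `lift`, powers `k ≡ 1 mod (N ^ 2)!` detect shift
equivalence. -/
theorem SE.of_pow_modEq [Fintype G] [DecidableEq G] {R : Type*} [Semiring R] {c : R →+* ℤ}
    (hc : Function.Injective c) {A : Matrix ι ι (MonoidAlgebra R G)}
    {B : Matrix κ κ (MonoidAlgebra R G)} {N k : ℕ} (hN : N ≠ 1)
    (hA : Fintype.card (ι × G) ≤ N) (hB : Fintype.card (κ × G) ≤ N) (hk1 : 1 ≤ k)
    (hk : k ≡ 1 [MOD (N ^ 2).factorial]) (h : SE (A ^ k) (B ^ k)) : SE A B := by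
  refine SE.of_pow hc hk1 (fun x y hx hy hxy => ?_) h
  obtain ⟨hxi, hxd⟩ := finrank_adjoin_le_of_isRoot (Matrix.charpoly_monic _) hx
  obtain ⟨hyi, hyd⟩ := finrank_adjoin_le_of_isRoot (Matrix.charpoly_monic _) hy
  rw [Matrix.charpoly_natDegree_eq_dim] at hxd hyd
  rcases hxy with h0 | h0
  · exact geom_sum_ne_zero_of_modEq hN hk1 hk hxi hyi (hxd.trans hA) (hyd.trans hB) h0
  · rw [geom_sum₂_comm]
    exact geom_sum_ne_zero_of_modEq hN hk1 hk hyi hxi (hyd.trans hB) (hxd.trans hA) h0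

theorem exists_natCast_eq_of_isRoot {α : Type*} [Fintype α] [DecidableEq α]
    (hα : Fintype.card α ≤ 1) {M : Matrix α α ℕ} {x : ℂ}
    (hx : ((M.map (Nat.castRingHom ℤ)).charpoly.map (algebraMap ℤ ℂ)).IsRoot x) :
    ∃ a : ℕ, x = a := by
  rw [← Matrix.charpoly_map, Polynomial.IsRoot, Matrix.eval_charpoly] at hx
  have hsub : Subsingleton α := Fintype.card_le_one_iff_subsingleton.mp hα
  rcases isEmpty_or_nonempty α with hα | ⟨⟨a⟩⟩
  · simp at hx
  · have := uniqueOfSubsingleton a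
    rw [Matrix.det_unique] at hx
    refine ⟨M default default, ?_⟩
    simpa [sub_eq_zero] using hx

/-- Over `ℕ[G]` all powers detect shift equivalence if the matrices have size at most `1` after
`lift`, because their eigenvalues are natural numbers. -/
theorem SE.of_pow_of_card_le_one [Fintype G] [DecidableEq G] {A : Matrix ι ι (MonoidAlgebra ℕ G)}
    {B : Matrix κ κ (MonoidAlgebra ℕ G)} {k : ℕ} (hA : Fintype.card (ι × G) ≤ 1)
    (hB : Fintype.card (κ × G) ≤ 1) (hk1 : 1 ≤ k) (h : SE (A ^ k) (B ^ k)) : SE A B := by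
  refine SE.of_pow (c := Nat.castRingHom ℤ) Nat.cast_injective hk1 (fun x y hx hy hxy => ?_) h
  obtain ⟨a, rfl⟩ := exists_natCast_eq_of_isRoot hA hx
  obtain ⟨b, rfl⟩ := exists_natCast_eq_of_isRoot hB hy
  have hne : ∑ i ∈ Finset.range k, a ^ i * b ^ (k - 1 - i) ≠ 0 := by
    rw [Ne, Finset.sum_eq_zero_iff]
    push Not
    rcases hxy with h0 | h0
    · have ha : a ≠ 0 := by exact_mod_cast h0
      exact ⟨k - 1, Finset.mem_range.mpr (by omega), by simp [ha]⟩
    · have hb : b ≠ 0 := by exact_mod_cast h0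
      exact ⟨0, Finset.mem_range.mpr (by omega), by simp [hb]⟩
  exact_mod_cast hne

/-- Beyond the equivalence with shift equivalence of suitable powers, the characterizations of
shift equivalence hold over every semiring. -/
theorem tfae_SE {S : Type*} [Semiring S] {A : Matrix ι ι S} {B : Matrix κ κ S} (m : ℕ)
    (h : ∀ k, 1 ≤ k → k ≡ 1 [MOD m.factorial] → SE (A ^ k) (B ^ k) → SE A B) :
    List.TFAE [
      SE A B,
      ∃ N : ℕ, ∀ n ≥ N, ESSE (A ^ n) (B ^ n),
      ∃ N : ℕ, ∀ n ≥ N, SE (A ^ n) (B ^ n),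
      ∃ k : ℕ, 1 ≤ k ∧ k ≡ 1 [MOD m.factorial] ∧ SE (A ^ k) (B ^ k)] := by
  tfae_have 1 → 2 := SE.exists_forall_esse
  tfae_have 2 → 3 := fun ⟨N, hN⟩ => ⟨N, fun n hn => (hN n hn).se⟩
  tfae_have 3 → 4 := fun ⟨N, hN⟩ => by
    refine ⟨N * m.factorial + 1, by omega, ?_, hN _ ?_⟩
    · exact (Nat.modEq_iff_dvd' (by omega)).mpr ⟨N, by simp [mul_comm]⟩ |>.symm
    · have := Nat.le_mul_of_pos_right N m.factorial_pos
      omega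
  tfae_have 4 → 1 := fun ⟨k, hk1, hk, hse⟩ => h k hk1 hk hse
  tfae_finish

end GroupRing

/-! ### Counting paths by group-ring matrices -/

section Counting

/-- The type `T` is finite with exactly `n` elements. -/
def HasCard (T : Type*) (n : ℕ) : Prop := Finite T ∧ Nat.card T = n

theorem HasCard.of_equiv {T T' : Type*} {n : ℕ} (h : HasCard T n) (e : T ≃ T') : HasCard T' n := by
  have := h.1
  exact ⟨Finite.of_equiv T e, by rw [← Nat.card_congr e, h.2]⟩

theorem HasCard.nonempty_equiv {T T' : Type*} {n : ℕ} (h : HasCard T n) (h' : HasCard T' n) :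
    Nonempty (T ≃ T') := by
  have := h.1
  have := h'.1
  exact (Finite.card_eq).mp (h.2.trans h'.2.symm)

theorem HasCard.prod {T T' : Type*} {n n' : ℕ} (h : HasCard T n) (h' : HasCard T' n') :
    HasCard (T × T') (n * n') := by
  have := h.1
  have := h'.1
  exact ⟨inferInstance, by rw [Nat.card_prod, h.2, h'.2]⟩

theorem hasCard_fin (n : ℕ) : HasCard (Fin n) n := ⟨inferInstance, Nat.card_fin n⟩

theorem HasCard.of_fibers {T α : Type*} [Fintype α] (f : T → α) {n : α → ℕ}
    (h : ∀ a, HasCard {t // f t = a} (n a)) : HasCard T (∑ a, n a) := by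
  have := fun a => (h a).1
  refine HasCard.of_equiv ⟨inferInstance, ?_⟩ (Equiv.sigmaFiberEquiv f)
  rw [Nat.card_sigma]
  exact Finset.sum_congr rfl fun a _ => (h a).2

theorem HasCard.of_fibers_const {T α : Type*} (f : T → α) {m n : ℕ} (hα : HasCard α m)
    (h : ∀ a, HasCard {t // f t = a} n) : HasCard T (m * n) := by
  have := hα.1
  have := Fintype.ofFinite α
  have h1 := HasCard.of_fibers f h
  rwa [Finset.sum_const, Finset.card_univ, ← Nat.card_eq_fintype_card, hα.2, smul_eq_mul] at h1

variable {G ι κ ν : Type*}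

/-- A set `E` of labeled arrows, with source, target and label given by `f`, has adjacency
matrix `M`. -/
def HasAdjacency {E : Type*} (f : E → ι × κ × G) (M : Matrix ι κ (MonoidAlgebra ℕ G)) : Prop :=
  ∀ i j g, HasCard {e // f e = (i, j, g)} ((M i j).coeff g)

/-- Two sets of labeled arrows with the same adjacency matrix are isomorphic. -/
theorem HasAdjacency.exists_equiv {E F : Type*} {f : E → ι × κ × G} {f' : F → ι × κ × G}
    {M : Matrix ι κ (MonoidAlgebra ℕ G)} (h : HasAdjacency f M) (h' : HasAdjacency f' M) :
    ∃ e : E ≃ F, ∀ a, f' (e a) = f a := by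
  have key : ∀ c : ι × κ × G, Nonempty ({a // f a = c} ≃ {b // f' b = c}) := fun c =>
    (h c.1 c.2.1 c.2.2).nonempty_equiv (h' c.1 c.2.1 c.2.2)
  exact ⟨Equiv.ofFiberEquiv fun c => (key c).some, Equiv.ofFiberEquiv_map _⟩

/-- The arrows of a rectangular matrix over `ℕ[G]`, the analogue of `Edge`. -/
structure Arrow (M : Matrix ι κ (MonoidAlgebra ℕ G)) where
  /-- the source -/
  src : ι
  /-- the target -/
  tgt : κ
  /-- the label -/
  label : G
  /-- the number of the arrow among those with the same source, target and label -/
  idx : Fin ((M src tgt).coeff label)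

/-- Source, target and label of an arrow. -/
def Arrow.data {M : Matrix ι κ (MonoidAlgebra ℕ G)} (e : Arrow M) : ι × κ × G :=
  (e.src, e.tgt, e.label)

theorem Arrow.hasAdjacency (M : Matrix ι κ (MonoidAlgebra ℕ G)) :
    HasAdjacency (Arrow.data (M := M)) M := by
  intro i j g
  refine (hasCard_fin _).of_equiv
    { toFun := fun n => ⟨⟨i, j, g, n⟩, rfl⟩
      invFun := fun e => e.1.idx.cast (by
        have h := e.2
        simp only [Arrow.data, Prod.mk.injEq] at h
        rw [h.1, h.2.1, h.2.2])
      left_inv := fun n => rfl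
      right_inv := ?_ }
  rintro ⟨⟨i', j', g', n⟩, h⟩
  simp only [Arrow.data, Prod.mk.injEq] at h
  obtain ⟨rfl, rfl, rfl⟩ := h
  rfl

/-- Source, target and label of an edge. -/
def Edge.data {A : Matrix ι ι (MonoidAlgebra ℕ G)} (e : Edge A) : ι × ι × G :=
  (e.src, e.tgt, e.label)

/-- The arrows of a square matrix are the edges of its graph. -/
def edgeEquivArrow (A : Matrix ι ι (MonoidAlgebra ℕ G)) : Arrow A ≃ Edge A where
  toFun e := ⟨e.src, e.tgt, e.label, e.idx⟩
  invFun e := ⟨e.src, e.tgt, e.label, e.idx⟩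
  left_inv _ := rfl
  right_inv _ := rfl

theorem Edge.hasAdjacency (A : Matrix ι ι (MonoidAlgebra ℕ G)) :
    HasAdjacency (Edge.data (A := A)) A := fun i j g =>
  (Arrow.hasAdjacency A i j g).of_equiv
    ((edgeEquivArrow A).subtypeEquiv fun _ => Iff.rfl)

theorem Edge.finite [Finite G] [Finite ι] (A : Matrix ι ι (MonoidAlgebra ℕ G)) :
    Finite (Edge A) := by
  have := Fintype.ofFinite G
  have := Fintype.ofFinite ι
  exact (HasCard.of_fibers Edge.data fun c => Edge.hasAdjacency A c.1 c.2.1 c.2.2).1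

variable [Group G]

/-- A set is counted by a coefficient of a product of two matrices over `ℕ[G]` if it decomposes
accordingly, over the intermediate states `(c, a)`. -/
theorem hasCard_coeff_mul [Fintype G] [Fintype κ] {M : Matrix ι κ (MonoidAlgebra ℕ G)}
    {P : Matrix κ ν (MonoidAlgebra ℕ G)} {i : ι} {j : ν} {g : G} {T : Type*} (f : T → κ × G)
    (h : ∀ c a, HasCard {t // f t = (c, a)} ((M i c).coeff a * (P c j).coeff (a⁻¹ * g))) :
    HasCard T (((M * P) i j).coeff g) := by
  have h1 : ((M * P) i j).coeff g =
      ∑ p : κ × G, (M i p.1).coeff p.2 * (P p.1 j).coeff (p.2⁻¹ * g) := by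
    rw [Matrix.mul_apply, MonoidAlgebra.coeff_sum, Finsupp.finsetSum_apply,
      Fintype.sum_prod_type]
    exact Finset.sum_congr rfl fun c _ => coeff_mul_eq_sum _ _ _
  rw [h1]
  exact HasCard.of_fibers f fun p => h p.1 p.2

/-- The composable pairs of arrows. -/
abbrev Pair {E F : Type*} (f : E → ι × κ × G) (f' : F → κ × ν × G) : Type _ :=
  {p : E × F // (f p.1).2.1 = (f' p.2).1}

/-- Source, target and label of a composable pair of arrows. -/
def Pair.data {E F : Type*} (f : E → ι × κ × G) (f' : F → κ × ν × G) (p : Pair f f') :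
    ι × ν × G :=
  ((f p.1.1).1, (f' p.1.2).2.1, (f p.1.1).2.2 * (f' p.1.2).2.2)

theorem HasAdjacency.pair [Fintype G] [Fintype κ] {E F : Type*} {f : E → ι × κ × G}
    {f' : F → κ × ν × G} {M : Matrix ι κ (MonoidAlgebra ℕ G)} {P : Matrix κ ν (MonoidAlgebra ℕ G)}
    (h : HasAdjacency f M) (h' : HasAdjacency f' P) :
    HasAdjacency (Pair.data f f') (M * P) := by
  intro i j g
  refine hasCard_coeff_mul (fun t => (f t.1.1.1).2) fun c a => ?_
  refine ((h i c a).prod (h' c j (a⁻¹ * g))).of_equiv ?_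
  refine
    { toFun := fun q => ⟨⟨⟨(q.1.1, q.2.1), ?_⟩, ?_⟩, ?_⟩
      invFun := fun t => (⟨t.1.1.1.1, ?_⟩, ⟨t.1.1.1.2, ?_⟩)
      left_inv := fun q => rfl
      right_inv := fun t => rfl }
  · rw [q.1.2, q.2.2]
  · simp [Pair.data, q.1.2, q.2.2]
  · rw [q.1.2]
  · have h1 := congrArg Prod.fst t.1.2
    exact Prod.ext h1 t.2
  · have h1 := t.1.2
    have h2 := t.1.1.2
    have h3 := t.2
    simp only [Pair.data, Prod.ext_iff] at h1 h3 ⊢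
    refine ⟨?_, h1.2.1, ?_⟩
    · rw [← h2]; exact h3.1
    · exact eq_inv_mul_of_mul_eq ((congrArg (· * _) h3.2.symm).trans h1.2.2)

/-- The list `l` of edges is a path from `i` to `j` with label `g`. -/
def IsPath {A : Matrix ι ι (MonoidAlgebra ℕ G)} : List (Edge A) → ι → ι → G → Prop
  | [], i, j, g => i = j ∧ g = 1
  | e :: l, i, j, g => e.src = i ∧ IsPath l e.tgt j (e.label⁻¹ * g)

/-- The paths with `r` edges, each given with its source, target and label. -/
abbrev Path (A : Matrix ι ι (MonoidAlgebra ℕ G)) (r : ℕ) : Type _ :=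
  {w : List (Edge A) × ι × ι × G // w.1.length = r ∧ IsPath w.1 w.2.1 w.2.2.1 w.2.2.2}

/-- Source, target and label of a path. -/
def Path.data {A : Matrix ι ι (MonoidAlgebra ℕ G)} {r : ℕ} (w : Path A r) : ι × ι × G := w.1.2

/-- A path with `r + 1` edges is an edge followed by a path with `r` edges. -/
def pathSuccEquiv (A : Matrix ι ι (MonoidAlgebra ℕ G)) (r : ℕ) :
    Pair (Edge.data (A := A)) (Path.data (A := A) (r := r)) ≃ Path A (r + 1) where
  toFun p := ⟨(p.1.1 :: p.1.2.1.1, p.1.1.src, p.1.2.1.2.2.1, p.1.1.label * p.1.2.1.2.2.2), by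
    simp [p.1.2.2.1], rfl, by
      have h := p.1.2.2.2
      have h2 : p.1.1.tgt = p.1.2.1.2.1 := p.2
      rwa [inv_mul_cancel_left, h2]⟩
  invFun w := match w with
    | ⟨(e :: l, _, j, g), h⟩ =>
      ⟨(e, ⟨(l, e.tgt, j, e.label⁻¹ * g), Nat.succ.inj h.1, h.2.2⟩), rfl⟩
  left_inv p := by
    obtain ⟨⟨e, ⟨⟨l, i, j, g⟩, h⟩⟩, hp⟩ := p
    have hp' : e.tgt = i := hp
    subst hp'
    refine Subtype.ext (Prod.ext rfl (Subtype.ext ?_))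
    simp
  right_inv w := by
    obtain ⟨⟨l, i, j, g⟩, h⟩ := w
    match l, h with
    | e :: l, h =>
      have h1 : e.src = i := h.2.1
      subst h1
      refine Subtype.ext ?_
      simp

theorem Path.hasAdjacency [Fintype G] [Fintype ι] [DecidableEq ι]
    (A : Matrix ι ι (MonoidAlgebra ℕ G)) (r : ℕ) :
    HasAdjacency (Path.data (A := A) (r := r)) (A ^ r) := by
  classical
  induction r with
  | zero =>
    intro i j g
    by_cases h : i = j ∧ g = 1
    · obtain ⟨rfl, rfl⟩ := h
      have h1 : ((A ^ 0) i i).coeff 1 = 1 := by simp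
      rw [h1]
      have : Unique {e : Path A 0 // e.data = (i, i, 1)} :=
        { default := ⟨⟨([], i, i, 1), rfl, rfl, rfl⟩, rfl⟩
          uniq := by
            rintro ⟨⟨⟨l, i', j', g'⟩, h⟩, h'⟩
            obtain rfl : l = [] := List.length_eq_zero_iff.mp h.1
            exact Subtype.ext (Subtype.ext (Prod.ext rfl h')) }
      exact ⟨inferInstance, Nat.card_unique⟩
    · have h1 : ((A ^ 0) i j).coeff g = 0 := by
        by_cases hij : i = j
        · subst hij
          have hg : g ≠ 1 := fun e => h ⟨rfl, e⟩
          simp [MonoidAlgebra.one_def, hg.symm]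
        · simp [hij]
      rw [h1]
      have : IsEmpty {e : Path A 0 // e.data = (i, j, g)} := by
        refine ⟨?_⟩
        rintro ⟨⟨⟨l, i', j', g'⟩, h2⟩, h'⟩
        obtain rfl : l = [] := List.length_eq_zero_iff.mp h2.1
        simp only [Path.data, Prod.mk.injEq] at h'
        obtain ⟨rfl, rfl, rfl⟩ := h'
        exact h h2.2
      exact ⟨inferInstance, Nat.card_of_isEmpty⟩
  | succ r ih =>
    rw [pow_succ']
    intro i j g
    refine ((Edge.hasAdjacency A).pair ih i j g).of_equiv
      ((pathSuccEquiv A r).subtypeEquiv fun p => ?_)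
    exact Iff.rfl

end Counting

/-! ### Coordinates on the extension of an edge shift -/

section Coordinates

variable {G ι : Type*} {A : Matrix ι ι (MonoidAlgebra ℕ G)}

theorem ext_of_coords {z z' : ExtSpace (EdgeShift A) G} (h : ∀ k, z.1.1 k = z'.1.1 k)
    (h0 : z.2 = z'.2) : z = z' :=
  Prod.ext (Subtype.ext (funext h)) h0

variable [TopologicalSpace G]

theorem continuous_edge (k : ℤ) :
    Continuous fun z : ExtSpace (EdgeShift A) G => z.1.1 k :=
  (continuous_apply k).comp (continuous_subtype_val.comp
    (continuous_fst (X := EdgeShift A) (Y := G)))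

theorem compactSpace_extSpace [Finite G] [Finite ι] (A : Matrix ι ι (MonoidAlgebra ℕ G)) :
    CompactSpace (ExtSpace (EdgeShift A) G) := by
  have := Edge.finite A
  have hclosed : IsClosed {x : ℤ → Edge A | ∀ k, (x k).tgt = (x (k + 1)).src} := by
    rw [Set.ofPred_forall]
    refine isClosed_iInter fun k => ?_
    have hc : Continuous fun x : ℤ → Edge A => (x k, x (k + 1)) :=
      (continuous_apply k).prodMk (continuous_apply (k + 1))
    exact (isClosed_discrete {p : Edge A × Edge A | p.1.tgt = p.2.src}).preimage hc
  have : CompactSpace (EdgeShift A) := isCompact_iff_compactSpace.mp hclosed.isCompact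
  exact inferInstanceAs (CompactSpace (EdgeShift A × G))

variable [Group G]

variable [DiscreteTopology G]

theorem extension_apply_fst (z : ExtSpace (EdgeShift A) G) (k : ℤ) :
    (extension A z).1.1 k = z.1.1 (k + 1) := rfl

theorem extension_apply_snd (z : ExtSpace (EdgeShift A) G) :
    (extension A z).2 = z.2 * (z.1.1 0).label := rfl

theorem extension_inv_apply_fst (z : ExtSpace (EdgeShift A) G) (k : ℤ) :
    ((extension A)⁻¹ z).1.1 k = z.1.1 (k - 1) := rfl

theorem zpow_extension_fst (n : ℤ) (z : ExtSpace (EdgeShift A) G) (k : ℤ) :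
    ((extension A ^ n) z).1.1 k = z.1.1 (k + n) := by
  induction n generalizing z with
  | zero => rw [zpow_zero, add_zero]; rfl
  | succ n ih =>
    rw [zpow_add_one, Homeomorph.mul_apply, ih, extension_apply_fst]
    exact congrArg z.1.1 (by ring)
  | pred n ih =>
    rw [zpow_sub_one, Homeomorph.mul_apply, ih, extension_inv_apply_fst]
    exact congrArg z.1.1 (by ring)

/-- The position at time `k`: the `G`-coordinate of the `k`-th iterate of the extension. -/
def pos (z : ExtSpace (EdgeShift A) G) (k : ℤ) : G := ((extension A ^ k) z).2

theorem pos_zero (z : ExtSpace (EdgeShift A) G) : pos z 0 = z.2 := by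
  rw [pos, zpow_zero]; rfl

theorem pos_zpow (n : ℤ) (z : ExtSpace (EdgeShift A) G) (k : ℤ) :
    pos ((extension A ^ n) z) k = pos z (k + n) := by
  rw [pos, pos, zpow_add, Homeomorph.mul_apply]

theorem pos_add_one (z : ExtSpace (EdgeShift A) G) (k : ℤ) :
    pos z (k + 1) = pos z k * (z.1.1 k).label := by
  rw [pos, add_comm, zpow_add, zpow_one, Homeomorph.mul_apply, extension_apply_snd,
    zpow_extension_fst, zero_add]
  rfl

theorem extension_smul (g : G) (z : ExtSpace (EdgeShift A) G) :
    extension A (g • z) = g • extension A z := Prod.ext rfl (mul_assoc _ _ _)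

theorem zpow_extension_smul (n : ℤ) (g : G) (z : ExtSpace (EdgeShift A) G) :
    (extension A ^ n) (g • z) = g • (extension A ^ n) z := by
  induction n generalizing z with
  | zero => rw [zpow_zero]; rfl
  | succ n ih => rw [zpow_add_one, Homeomorph.mul_apply, extension_smul, ih]; rfl
  | pred n ih =>
    have h : (extension A)⁻¹ (g • z) = g • (extension A)⁻¹ z := by
      apply (extension A).injective
      rw [extension_smul, ← Homeomorph.mul_apply, ← Homeomorph.mul_apply, mul_inv_cancel]; rfl
    rw [zpow_sub_one, Homeomorph.mul_apply, h, ih]; rfl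

theorem pos_smul (g : G) (z : ExtSpace (EdgeShift A) G) (k : ℤ) :
    pos (g • z) k = g * pos z k := by
  rw [pos, zpow_extension_smul]; rfl

theorem exists_of_path (x : EdgeShift A) (m : ℤ) (g : G) :
    ∃ z : ExtSpace (EdgeShift A) G, z.1 = x ∧ pos z m = g := by
  let z : ExtSpace (EdgeShift A) G := (x, 1)
  exact ⟨(g * (pos z m)⁻¹) • z, rfl, by rw [pos_smul, inv_mul_cancel_right]⟩

theorem continuous_pos (k : ℤ) :
    Continuous fun z : ExtSpace (EdgeShift A) G => pos z k :=
  (continuous_snd (X := EdgeShift A) (Y := G)).comp (extension A ^ k).continuous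

end Coordinates

/-! ### Cutting bi-infinite paths into blocks -/

section Blocks

variable {G ι : Type*} {A : Matrix ι ι (MonoidAlgebra ℕ G)}

/-- The list of the `r` edges of `x` from time `k` on. -/
def word (x : ℤ → Edge A) : ℤ → ℕ → List (Edge A)
  | _, 0 => []
  | k, r + 1 => x k :: word x (k + 1) r

@[simp]
theorem length_word (x : ℤ → Edge A) (k : ℤ) (r : ℕ) : (word x k r).length = r := by
  induction r generalizing k with
  | zero => rfl
  | succ r ih => simp [word, ih]

theorem getElem_word (x : ℤ → Edge A) (k : ℤ) (r s : ℕ) (h : s < (word x k r).length) :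
    (word x k r)[s] = x (k + s) := by
  induction r generalizing k s with
  | zero => simp at h
  | succ r ih =>
    match s with
    | 0 => simp [word]
    | s + 1 =>
      simp only [word, List.getElem_cons_succ]
      rw [ih]
      congr 1
      push_cast
      ring

theorem word_congr {x x' : ℤ → Edge A} {k k' : ℤ} {r : ℕ}
    (h : ∀ s : ℕ, s < r → x (k + s) = x' (k' + s)) : word x k r = word x' k' r := by
  refine List.ext_getElem (by simp) fun s h1 h2 => ?_
  rw [getElem_word, getElem_word]
  exact h s (by simpa using h1)

/-- A function on the edge shift that depends on finitely many coordinates is continuous. -/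
theorem continuous_of_finset {D : Type*} [TopologicalSpace D] {f : EdgeShift A → D} (S : Finset ℤ)
    (h : ∀ x x' : EdgeShift A, (∀ k ∈ S, x.1 k = x'.1 k) → f x = f x') : Continuous f := by
  refine IsLocallyConstant.continuous ((IsLocallyConstant.iff_exists_open f).mpr fun x => ?_)
  refine ⟨⋂ k ∈ S, {y | y.1 k = x.1 k}, ?_, by simp, fun y hy => h y x (by simpa using hy)⟩
  refine isOpen_biInter_finset fun k _ => ?_
  have hc : Continuous fun y : EdgeShift A => y.1 k :=
    (continuous_apply k).comp continuous_subtype_val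
  exact (isOpen_discrete ({x.1 k} : Set (Edge A))).preimage hc

variable [Group G]

theorem isPath_word {x : ℤ → Edge A} (hx : ∀ k, (x k).tgt = (x (k + 1)).src) (k : ℤ) (r : ℕ) :
    IsPath (word x k r) (x k).src (x (k + r)).src ((word x k r).map Edge.label).prod := by
  induction r generalizing k with
  | zero => simp [word, IsPath]
  | succ r ih =>
    refine ⟨rfl, ?_⟩
    have h := ih (k + 1)
    rw [hx]
    have e : k + ((r + 1 : ℕ) : ℤ) = k + 1 + r := by push_cast; ring
    rw [e]
    simpa [word] using h

theorem IsPath.src_eq {l : List (Edge A)} {i j : ι} {g : G} (h : IsPath l i j g)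
    (h0 : 0 < l.length) : l[0].src = i := by
  match l, h with
  | e :: l, h => exact h.1

theorem IsPath.tgt_getElem {l : List (Edge A)} {i j : ι} {g : G} (h : IsPath l i j g) {s : ℕ}
    (hs : s + 1 < l.length) : l[s].tgt = l[s + 1].src := by
  induction l generalizing i g s with
  | nil => simp at hs
  | cons e l ih =>
    match s with
    | 0 => exact (h.2.src_eq (by simpa using hs)).symm
    | s + 1 => exact ih h.2 (by simpa using hs)

theorem IsPath.tgt_eq {l : List (Edge A)} {i j : ι} {g : G} (h : IsPath l i j g) {s : ℕ}
    (hs : s + 1 = l.length) : l[s].tgt = j := by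
  induction l generalizing i g s with
  | nil => simp at hs
  | cons e l ih =>
    match s with
    | 0 =>
      obtain rfl : l = [] := List.length_eq_zero_iff.mp (by simpa using hs.symm)
      exact h.2.1
    | s + 1 => exact ih h.2 (by simpa using hs)

theorem IsPath.label_eq {l : List (Edge A)} {i j : ι} {g : G} (h : IsPath l i j g) :
    g = (l.map Edge.label).prod := by
  induction l generalizing i g with
  | nil => exact h.2
  | cons e l ih =>
    rw [List.map_cons, List.prod_cons, ← ih h.2, mul_inv_cancel_left]

theorem Path.ext_list {r : ℕ} (hr : 1 ≤ r) {w w' : Path A r} (h : w.1.1 = w'.1.1) : w = w' := by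
  obtain ⟨⟨l, i, j, g⟩, hl, hp⟩ := w
  obtain ⟨⟨l', i', j', g'⟩, hl', hp'⟩ := w'
  obtain rfl : l = l' := h
  dsimp only at hl hp hp'
  have h1 : i = i' := (hp.src_eq (by omega)).symm.trans (hp'.src_eq (by omega))
  have h2 : j = j' := (hp.tgt_eq (s := r - 1) (by omega)).symm.trans (hp'.tgt_eq (by omega))
  have h3 : g = g' := hp.label_eq.trans hp'.label_eq.symm
  subst h1 h2 h3
  rfl

/-- The `q`-th block of `x`: its edges at the times `r * q, …, r * q + r - 1`. -/
def block (r : ℕ) (x : EdgeShift A) (q : ℤ) : Path A r :=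
  ⟨(word x.1 (r * q) r, (x.1 (r * q)).src, (x.1 (r * q + r)).src,
    ((word x.1 (r * q) r).map Edge.label).prod), length_word _ _ _, isPath_word x.2 _ _⟩

theorem block_src_succ (r : ℕ) (x : EdgeShift A) (q : ℤ) :
    (block r x q).data.2.1 = (block r x (q + 1)).data.1 := by
  simp only [block, Path.data]
  rw [mul_add, mul_one]

theorem eq_of_block_eq {r : ℕ} (hr : 1 ≤ r) {x x' : EdgeShift A} {m : ℤ}
    (h : block r x (m / r) = block r x' (m / r)) : x.1 m = x'.1 m := by
  have hr' : (0 : ℤ) < r := by exact_mod_cast hr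
  have h0 := Int.emod_nonneg m hr'.ne'
  have h1 := Int.emod_lt_of_pos m hr'
  have h2 : (r : ℤ) * (m / r) + (m % r).toNat = m := by
    rw [Int.toNat_of_nonneg h0, Int.mul_ediv_add_emod]
  have h3 : (m % r).toNat < r := by omega
  have hb : word x.1 (r * (m / r)) r = word x'.1 (r * (m / r)) r :=
    congrArg (fun w : Path A r => w.1.1) h
  have h4 : (word x.1 (r * (m / r)) r)[(m % r).toNat]'(by simpa using h3) =
      (word x'.1 (r * (m / r)) r)[(m % r).toNat]'(by simpa using h3) := by
    simp only [hb]
  rwa [getElem_word, getElem_word, h2] at h4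

theorem block_injective {r : ℕ} (hr : 1 ≤ r) {x x' : EdgeShift A}
    (h : ∀ q, block r x q = block r x' q) : x = x' :=
  Subtype.ext (funext fun m => eq_of_block_eq hr (h (m / r)))

theorem block_congr {r : ℕ} {x x' : EdgeShift A} {q q' : ℤ}
    (h : ∀ s : ℕ, s ≤ r → x.1 (r * q + s) = x'.1 (r * q' + s)) : block r x q = block r x' q' := by
  have hw : word x.1 (r * q) r = word x'.1 (r * q') r := word_congr fun s hs => h s hs.le
  have h0 := h 0 (Nat.zero_le _)
  simp only [Nat.cast_zero, add_zero] at h0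
  exact Subtype.ext (by simp only [block, hw, h r le_rfl, h0])

/-- Every sequence of consecutive blocks comes from a bi-infinite path. -/
theorem exists_block_eq {r : ℕ} (hr : 1 ≤ r) (W : ℤ → Path A r)
    (hW : ∀ q, (W q).data.2.1 = (W (q + 1)).data.1) : ∃ x : EdgeShift A, ∀ q, block r x q = W q := by
  have hr' : (0 : ℤ) < r := by exact_mod_cast hr
  have hlt : ∀ m : ℤ, (m % r).toNat < (W (m / r)).1.1.length := fun m => by
    have h0 := Int.emod_nonneg m hr'.ne'
    have h1 := Int.emod_lt_of_pos m hr'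
    rw [(W (m / r)).2.1]; omega
  have key : ∀ (q q' : ℤ) (s s' : ℕ) (hs : s < (W q).1.1.length) (hs' : s' < (W q').1.1.length),
      q = q' → s = s' → (W q).1.1[s] = (W q').1.1[s'] := by
    rintro q _ s _ _ _ rfl rfl; rfl
  have hdm : ∀ (q : ℤ) (s : ℕ), s < r →
      (r * q + s) / (r : ℤ) = q ∧ (((r * q + s) % (r : ℤ)).toNat = s) := by
    intro q s hs
    have hs' : (s : ℤ) < r := by exact_mod_cast hs
    constructor
    · rw [add_comm, Int.add_mul_ediv_left _ _ hr'.ne',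
        Int.ediv_eq_zero_of_lt (by omega) hs', zero_add]
    · rw [add_comm, Int.add_mul_emod_self_left, Int.emod_eq_of_lt (by omega) hs']; simp
  let x : ℤ → Edge A := fun m => (W (m / r)).1.1[(m % r).toNat]'(hlt m)
  have hx : ∀ (q : ℤ) (s : ℕ) (hs : s < r),
      x (r * q + s) = (W q).1.1[s]'(by rw [(W q).2.1]; exact hs) := fun q s hs =>
    key _ _ _ _ _ _ (hdm q s hs).1 (hdm q s hs).2
  have hpath : ∀ m, (x m).tgt = (x (m + 1)).src := by
    intro m
    obtain ⟨q, s, hs, rfl⟩ : ∃ (q : ℤ) (s : ℕ), s < r ∧ m = r * q + s := by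
      have h0 := Int.emod_nonneg m hr'.ne'
      have h1 := Int.emod_lt_of_pos m hr'
      refine ⟨m / r, (m % r).toNat, by omega, ?_⟩
      rw [Int.toNat_of_nonneg h0, Int.mul_ediv_add_emod]
    rw [hx q s hs]
    have hlen := (W q).2.1
    by_cases hs' : s + 1 < r
    · have h1 := hx q (s + 1) hs'
      push_cast at h1
      rw [add_assoc, h1]
      exact (W q).2.2.tgt_getElem (by omega)
    · have h1 := hx (q + 1) 0 (by omega)
      have h2 : (r : ℤ) * q + s + 1 = r * (q + 1) + (0 : ℕ) := by
        have : (s : ℤ) + 1 = r := by exact_mod_cast (by omega : s + 1 = r)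
        push_cast
        linear_combination this
      rw [h2, h1, (W q).2.2.tgt_eq (by omega), (W (q + 1)).2.2.src_eq]
      exact hW q
  refine ⟨⟨x, hpath⟩, fun q => Path.ext_list hr ?_⟩
  refine List.ext_getElem ?_ fun s h1 h2 => ?_
  · rw [(W q).2.1]; exact length_word _ _ _
  · have hs : s < r := by rw [(W q).2.1] at h2; exact h2
    simp only [block]
    rw [getElem_word]
    exact hx q s hs

end Blocks

/-! ### From elementary strong shift equivalence of powers to conjugacy of powers -/

/-- The dynamical counterpart of elementary strong shift equivalence: if `T₁ = F' ∘ F` and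
`T₂ = F ∘ F'` with `F`, `F'` continuous and `F` equivariant, then `F` is a `G`-conjugacy. -/
theorem GConjugate.of_comp {G : Type*} [Group G] {Y₁ Y₂ : Type*} [TopologicalSpace Y₁]
    [TopologicalSpace Y₂] [MulAction G Y₁] [MulAction G Y₂] {T₁ : Y₁ ≃ₜ Y₁} {T₂ : Y₂ ≃ₜ Y₂}
    {F : Y₁ → Y₂} {F' : Y₂ → Y₁} (hF : Continuous F) (hF' : Continuous F')
    (h₁ : ∀ y, F' (F y) = T₁ y) (h₂ : ∀ y, F (F' y) = T₂ y)
    (hG : ∀ (g : G) (y : Y₁), F (g • y) = g • F y) : GConjugate G T₁ T₂ := by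
  have hcomm : ∀ y, F (T₁ y) = T₂ (F y) := fun y => by rw [← h₁, h₂]
  refine ⟨{ toFun := F, invFun := fun y => T₁.symm (F' y), left_inv := ?_, right_inv := ?_,
            continuous_toFun := hF, continuous_invFun := T₁.symm.continuous.comp hF' }, hcomm, hG⟩
  · intro y
    simp [h₁]
  · intro y
    apply T₂.injective
    rw [← hcomm, T₁.apply_symm_apply, h₂]

section Transfer

variable {G ι κ : Type*} [Group G]
  {A : Matrix ι ι (MonoidAlgebra ℕ G)} {B : Matrix κ κ (MonoidAlgebra ℕ G)}
  {U : Matrix ι κ (MonoidAlgebra ℕ G)} {V : Matrix κ ι (MonoidAlgebra ℕ G)} {r : ℕ}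

/-- The pairs `(v_q, u_{q+1})` obtained by regrouping the pairs `(u_q, v_q)` that encode the blocks
of `x`. -/
def regroup (e : Path A r ≃ Pair (Arrow.data (M := U)) (Arrow.data (M := V)))
    (he : ∀ w, Pair.data _ _ (e w) = w.data) (x : EdgeShift A) (q : ℤ) :
    Pair (Arrow.data (M := V)) (Arrow.data (M := U)) :=
  ⟨((e (block r x q)).1.2, (e (block r x (q + 1))).1.1), by
    have h1 := congrArg (fun d : ι × ι × G => d.2.1) (he (block r x q))
    have h2 := congrArg (fun d : ι × ι × G => d.1) (he (block r x (q + 1)))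
    exact h1.trans ((block_src_succ r x q).trans h2.symm)⟩

theorem exists_transfer (hr : 1 ≤ r)
    (e : Path A r ≃ Pair (Arrow.data (M := U)) (Arrow.data (M := V)))
    (he : ∀ w, Pair.data _ _ (e w) = w.data)
    (e' : Path B r ≃ Pair (Arrow.data (M := V)) (Arrow.data (M := U)))
    (he' : ∀ w, Pair.data _ _ (e' w) = w.data) (x : EdgeShift A) :
    ∃ y : EdgeShift B, ∀ q, block r y q = e'.symm (regroup e he x q) := by
  refine exists_block_eq hr _ fun q => ?_
  rw [← he', ← he', Equiv.apply_symm_apply, Equiv.apply_symm_apply]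
  exact (e (block r x (q + 1))).2

/-- The block map of extensions that encodes the blocks of a path over `A` by pairs `(u_q, v_q)` and
decodes the pairs `(v_q, u_{q+1})` to a path over `B`; the position is multiplied by the label
of `u_0`. -/
noncomputable def transfer (hr : 1 ≤ r)
    (e : Path A r ≃ Pair (Arrow.data (M := U)) (Arrow.data (M := V)))
    (he : ∀ w, Pair.data _ _ (e w) = w.data)
    (e' : Path B r ≃ Pair (Arrow.data (M := V)) (Arrow.data (M := U)))
    (he' : ∀ w, Pair.data _ _ (e' w) = w.data) (z : ExtSpace (EdgeShift A) G) :
    ExtSpace (EdgeShift B) G :=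
  ((exists_transfer hr e he e' he' z.1).choose, z.2 * (e (block r z.1 0)).1.1.label)

variable (hr : 1 ≤ r)
    (e : Path A r ≃ Pair (Arrow.data (M := U)) (Arrow.data (M := V)))
    (he : ∀ w, Pair.data _ _ (e w) = w.data)
    (e' : Path B r ≃ Pair (Arrow.data (M := V)) (Arrow.data (M := U)))
    (he' : ∀ w, Pair.data _ _ (e' w) = w.data)

theorem block_transfer (z : ExtSpace (EdgeShift A) G) (q : ℤ) :
    block r (transfer hr e he e' he' z).1 q = e'.symm (regroup e he z.1 q) :=
  (exists_transfer hr e he e' he' z.1).choose_spec q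

theorem transfer_smul (g : G) (z : ExtSpace (EdgeShift A) G) :
    transfer hr e he e' he' (g • z) = g • transfer hr e he e' he' z :=
  Prod.ext rfl (mul_assoc _ _ _)

variable [TopologicalSpace G] [DiscreteTopology G]

theorem continuous_transfer : Continuous (transfer hr e he e' he') := by
  have h1 : Continuous fun x : EdgeShift A => (exists_transfer hr e he e' he' x).choose := by
    refine Continuous.subtype_mk (continuous_pi fun m => ?_) _
    -- the edge at time `m` is determined by the blocks number `m / r` and `m / r + 1`
    refine continuous_of_finset (Finset.Icc (r * (m / r)) (r * (m / r) + r + r)) fun x x' h => ?_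
    refine eq_of_block_eq hr ?_
    have h0 : block r x (m / r) = block r x' (m / r) := block_congr fun s hs => by
      have hs' : (s : ℤ) ≤ r := by exact_mod_cast hs
      exact h _ (Finset.mem_Icc.mpr ⟨by omega, by omega⟩)
    have h1 : block r x (m / r + 1) = block r x' (m / r + 1) := block_congr fun s hs => by
      have hs' : (s : ℤ) ≤ r := by exact_mod_cast hs
      refine h _ (Finset.mem_Icc.mpr ⟨?_, ?_⟩) <;> rw [mul_add, mul_one] <;> omega
    refine ((exists_transfer hr e he e' he' x).choose_spec _).trans (Eq.trans ?_
      ((exists_transfer hr e he e' he' x').choose_spec _).symm)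
    simp only [regroup, h0, h1]
  have h2 : Continuous fun x : EdgeShift A => (e (block r x 0)).1.1.label :=
    continuous_of_finset (Finset.Icc 0 r) fun x x' h => by
      rw [block_congr (q := 0) (q' := 0) (x' := x')]
      intro s hs
      exact h _ (by simpa using hs)
  have h3 : Continuous fun z : EdgeShift A × G =>
      ((exists_transfer hr e he e' he' z.1).choose, z.2 * (e (block r z.1 0)).1.1.label) :=
    (h1.comp continuous_fst).prodMk (continuous_snd.mul (h2.comp continuous_fst))
  exact h3

theorem pos_natCast (z : ExtSpace (EdgeShift A) G) (k : ℤ) (n : ℕ) :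
    pos z (k + n) = pos z k * ((word z.1.1 k n).map Edge.label).prod := by
  induction n generalizing k with
  | zero => simp [word]
  | succ n ih =>
    have h : k + ((n + 1 : ℕ) : ℤ) = k + 1 + n := by push_cast; ring
    rw [h, ih, pos_add_one, word, List.map_cons, List.prod_cons, mul_assoc]

/-- The two block maps compose to the `r`-th power of the extension. -/
theorem transfer_transfer (z : ExtSpace (EdgeShift A) G) :
    transfer hr e' he' e he (transfer hr e he e' he' z) = (extension A ^ r) z := by
  have hz : ∀ k, ((extension A ^ r) z).1.1 k = z.1.1 (k + r) := fun k => by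
    rw [← zpow_natCast]; exact zpow_extension_fst _ _ _
  refine Prod.ext (block_injective hr fun q => ?_) ?_
  · rw [block_transfer]
    have h1 : regroup e' he' (transfer hr e he e' he' z).1 q = e (block r z.1 (q + 1)) := by
      refine Subtype.ext (Prod.ext ?_ ?_)
      · simp only [regroup, block_transfer, Equiv.apply_symm_apply]
      · simp only [regroup, block_transfer, Equiv.apply_symm_apply]
    rw [h1, Equiv.symm_apply_apply]
    refine block_congr fun s _ => ?_
    rw [hz]
    exact congrArg z.1.1 (by ring)
  · have h1 : (e' (block r (transfer hr e he e' he' z).1 0)).1.1 = (e (block r z.1 0)).1.2 := by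
      rw [block_transfer, Equiv.apply_symm_apply]; rfl
    have h2 : (e (block r z.1 0)).1.1.label * (e (block r z.1 0)).1.2.label =
        (block r z.1 0).data.2.2 :=
      congrArg (fun d : ι × ι × G => d.2.2) (he (block r z.1 0))
    have h3 : ((extension A ^ r) z).2 = pos z (0 + r) := by
      rw [zero_add, pos, zpow_natCast]
    rw [h3, pos_natCast, pos_zero]
    change z.2 * (e (block r z.1 0)).1.1.label *
      (e' (block r (transfer hr e he e' he' z).1 0)).1.1.label = _
    rw [h1, mul_assoc, h2]
    simp [block, Path.data]

end Transfer

/-- An elementary strong shift equivalence of `A ^ r` and `B ^ r` induces a `G`-conjugacy: a path with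
`r` edges has the same data as a composable pair of arrows of `U` and `V`, as both are counted by
`A ^ r = U * V`. -/
theorem gconjugate_pow_of_esse {G ι κ : Type*} [Group G] [Finite G] [TopologicalSpace G]
    [DiscreteTopology G] [Fintype ι] [DecidableEq ι] [Fintype κ] [DecidableEq κ]
    {A : Matrix ι ι (MonoidAlgebra ℕ G)} {B : Matrix κ κ (MonoidAlgebra ℕ G)} {r : ℕ} (hr : 1 ≤ r)
    (h : ESSE (A ^ r) (B ^ r)) : GConjugate G (extension A ^ r) (extension B ^ r) := by
  have := Fintype.ofFinite G
  obtain ⟨U, V, hA, hB⟩ := h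
  obtain ⟨e, he⟩ := (Path.hasAdjacency A r).exists_equiv
    (hA ▸ (Arrow.hasAdjacency U).pair (Arrow.hasAdjacency V))
  obtain ⟨e', he'⟩ := (Path.hasAdjacency B r).exists_equiv
    (hB ▸ (Arrow.hasAdjacency V).pair (Arrow.hasAdjacency U))
  exact GConjugate.of_comp (continuous_transfer hr e he e' he') (continuous_transfer hr e' he' e he)
    (transfer_transfer hr e he e' he') (transfer_transfer hr e' he' e he)
    (transfer_smul hr e he e' he')

/-! ### Essential vertices -/

/-- The vertex `j` is the end of a chain of `k` arrows, with sources `s` and targets `t`. -/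
def EndsChain {E ι : Type*} (s t : E → ι) : ℕ → ι → Prop
  | 0, _ => True
  | k + 1, j => ∃ e, t e = j ∧ EndsChain s t k (s e)

theorem EndsChain.of_le {E ι : Type*} {s t : E → ι} {k l : ℕ} (hkl : k ≤ l) {j : ι}
    (h : EndsChain s t l j) : EndsChain s t k j := by
  induction k generalizing l j with
  | zero => trivial
  | succ k ih =>
    obtain ⟨l, rfl⟩ : ∃ l', l = l' + 1 := ⟨l - 1, by omega⟩
    obtain ⟨e, he, h⟩ := h
    exact ⟨e, he, ih (by omega) h⟩

/-- In a graph with finitely many vertices, the end of a sufficiently long chain is the end of an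
infinite chain. -/
theorem exists_forall_endsChain {E ι : Type*} [Finite ι] (s t : E → ι) :
    ∃ N : ℕ, ∀ j, EndsChain s t N j →
      ∃ p : ℕ → E, t (p 0) = j ∧ ∀ k, t (p (k + 1)) = s (p k) := by
  let f : ℕ →o (Set ι)ᵒᵈ := ⟨fun k => OrderDual.toDual {j | EndsChain s t k j},
    fun k l hkl j hj => EndsChain.of_le hkl hj⟩
  obtain ⟨N, hN⟩ := WellFoundedGT.monotone_chain_condition f
  have hstep : ∀ j, EndsChain s t N j → EndsChain s t (N + 1) j := fun j hj => by
    have h : {j | EndsChain s t N j} = {j | EndsChain s t (N + 1) j} := hN (N + 1) (by omega)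
    exact (Set.ext_iff.mp h j).mp hj
  choose e he hes using hstep
  refine ⟨N, fun j hj => ?_⟩
  let c : ℕ → {e : E // EndsChain s t N (s e)} := fun k =>
    Nat.rec ⟨e j hj, hes j hj⟩ (fun _ d => ⟨e (s d.1) d.2, hes (s d.1) d.2⟩) k
  exact ⟨fun k => (c k).1, he j hj, fun k => he (s (c k).1) (c k).2⟩

/-- Trimming by commuting idempotents: if `F` and `P` project to the vertices that have a future
and a past, respectively, then `A` is shift equivalent to its trimmed version `P * A * F`. -/
theorem SE.of_trim {S ι : Type*} [Semiring S] [Fintype ι] [DecidableEq ι] {A P F : Matrix ι ι S}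
    {N : ℕ} (hN : 1 ≤ N) (hPP : P * P = P) (hPF : P * F = F * P) (hF : F * A * F = A * F)
    (hP : P * A * P = P * A) (hAP : A ^ N * P = A ^ N) (hFA : F * A ^ N = A ^ N) :
    SE A (P * A * F) := by
  have hPk : ∀ k, P * A ^ k * P = P * A ^ k := fun k => by
    induction k with
    | zero => simp [hPP]
    | succ k ih =>
      calc P * A ^ (k + 1) * P = P * A ^ k * (A * P) := by rw [pow_succ]; simp only [mul_assoc]
        _ = P * A ^ k * P * (A * P) := by rw [ih]
        _ = P * A ^ k * (P * A * P) := by simp only [mul_assoc]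
        _ = P * A ^ k * P * A := by rw [hP]; simp only [mul_assoc]
        _ = P * A ^ (k + 1) := by rw [ih, pow_succ, mul_assoc]
  have hpow : ∀ k, (P * A * F) ^ (k + 1) = P * A ^ (k + 1) * F := fun k => by
    induction k with
    | zero => simp
    | succ k ih =>
      calc (P * A * F) ^ (k + 1 + 1) = P * A ^ (k + 1) * (F * P) * (A * F) := by
            rw [pow_succ, ih]; simp only [mul_assoc]
        _ = (P * A ^ (k + 1) * P) * (F * A * F) := by rw [← hPF]; simp only [mul_assoc]
        _ = P * A ^ (k + 1 + 1) * F := by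
            rw [hPk, hF, pow_succ A (k + 1)]; simp only [mul_assoc]
  refine ⟨N + N, by omega, A ^ N * F, P * A ^ N, ?_, ?_, ?_, ?_⟩
  · calc A ^ (N + N) = (A ^ N * P) * (F * A ^ N) := by rw [hAP, hFA, pow_add]
      _ = A ^ N * (P * F) * A ^ N := by simp only [mul_assoc]
      _ = A ^ N * F * (P * A ^ N) := by rw [hPF]; simp only [mul_assoc]
  · obtain ⟨k, hk⟩ : ∃ k, N + N = k + 1 := ⟨N + N - 1, by omega⟩
    rw [hk, hpow, ← hk, pow_add]
    simp only [mul_assoc]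
  · calc A * (A ^ N * F) = A ^ N * (A * F) := by
          rw [← mul_assoc, ← pow_succ', pow_succ, mul_assoc]
      _ = (A ^ N * P) * (F * A * F) := by rw [hAP, hF]
      _ = A ^ N * (P * F) * A * F := by simp only [mul_assoc]
      _ = A ^ N * F * (P * A * F) := by rw [hPF]; simp only [mul_assoc]
  · calc P * A * F * (P * A ^ N) = P * A * (F * P) * A ^ N := by simp only [mul_assoc]
      _ = P * A * P * (F * A ^ N) := by rw [← hPF]; simp only [mul_assoc]
      _ = P * (A * A ^ N) := by rw [hP, hFA, mul_assoc]
      _ = P * A ^ N * A := by rw [← pow_succ', pow_succ, mul_assoc]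

section Core

variable {G ι : Type*}

/-- A vertex is essential if it lies on a bi-infinite path. -/
def IsEssential (A : Matrix ι ι (MonoidAlgebra ℕ G)) (i : ι) : Prop :=
  ∃ x : EdgeShift A, (x.1 0).src = i

/-- A vertex has a past if it is the end of a left-infinite path. -/
def HasPast (A : Matrix ι ι (MonoidAlgebra ℕ G)) (i : ι) : Prop :=
  ∃ p : ℕ → Edge A, (p 0).tgt = i ∧ ∀ k, (p (k + 1)).tgt = (p k).src

/-- A vertex has a future if it is the start of a right-infinite path. -/
def HasFuture (A : Matrix ι ι (MonoidAlgebra ℕ G)) (i : ι) : Prop :=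
  ∃ f : ℕ → Edge A, (f 0).src = i ∧ ∀ k, (f (k + 1)).src = (f k).tgt

open Classical in
/-- The core of `A`: the adjacency matrix of the subgraph of essential vertices, with zeros added in
the remaining rows and columns. -/
noncomputable def core (A : Matrix ι ι (MonoidAlgebra ℕ G)) : Matrix ι ι (MonoidAlgebra ℕ G) :=
  Matrix.of fun i j => if IsEssential A i ∧ IsEssential A j then A i j else 0

variable {A : Matrix ι ι (MonoidAlgebra ℕ G)}

theorem IsEssential.hasPast {i : ι} (h : IsEssential A i) : HasPast A i := by
  obtain ⟨x, rfl⟩ := h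
  refine ⟨fun k => x.1 (-1 - k), ?_, fun k => ?_⟩
  · have := x.2 (-1)
    simpa using this
  · have := x.2 (-1 - ((k + 1 : ℕ) : ℤ))
    rw [this]
    exact congrArg (fun m => (x.1 m).src) (by push_cast; ring)

theorem IsEssential.hasFuture {i : ι} (h : IsEssential A i) : HasFuture A i := by
  obtain ⟨x, rfl⟩ := h
  exact ⟨fun k => x.1 k, rfl, fun k => (x.2 k).symm⟩

theorem isEssential_of_hasPast_of_hasFuture {i : ι} (hp : HasPast A i) (hf : HasFuture A i) :
    IsEssential A i := by
  obtain ⟨p, hp0, hp⟩ := hp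
  obtain ⟨f, hf0, hf⟩ := hf
  let x : ℤ → Edge A := fun k => match k with
    | Int.ofNat n => f n
    | Int.negSucc n => p n
  refine ⟨⟨x, fun k => ?_⟩, hf0⟩
  match k with
  | Int.ofNat n => exact (hf n).symm
  | Int.negSucc 0 => exact hp0.trans hf0.symm
  | Int.negSucc (n + 1) => exact hp n

theorem exists_edge_of_ne_zero {i j : ι} (h : A i j ≠ 0) :
    ∃ e : Edge A, e.src = i ∧ e.tgt = j := by
  obtain ⟨g, hg⟩ : ∃ g, (A i j).coeff g ≠ 0 := by
    by_contra hno
    push Not at hno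
    exact h (MonoidAlgebra.ext (Finsupp.ext hno))
  exact ⟨⟨i, j, g, ⟨0, Nat.pos_of_ne_zero hg⟩⟩, rfl, rfl⟩

theorem HasPast.of_ne_zero {i j : ι} (h : A i j ≠ 0) (hi : HasPast A i) : HasPast A j := by
  obtain ⟨e, rfl, rfl⟩ := exists_edge_of_ne_zero h
  obtain ⟨p, hp0, hp⟩ := hi
  exact ⟨fun k => Nat.casesOn k e p, rfl, fun k => by cases k; exacts [hp0, hp _]⟩

theorem HasFuture.of_ne_zero {i j : ι} (h : A i j ≠ 0) (hj : HasFuture A j) : HasFuture A i := by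
  obtain ⟨e, rfl, rfl⟩ := exists_edge_of_ne_zero h
  obtain ⟨p, hp0, hp⟩ := hj
  exact ⟨fun k => Nat.casesOn k e p, rfl, fun k => by cases k; exacts [hp0, hp _]⟩

variable [Group G] [Fintype ι] [DecidableEq ι]

theorem endsChain_of_pow_ne_zero {N : ℕ} {i j : ι} (h : (A ^ N) i j ≠ 0) :
    EndsChain (E := Edge A) Edge.src Edge.tgt N j := by
  induction N generalizing j with
  | zero => trivial
  | succ N ih =>
    rw [pow_succ, Matrix.mul_apply] at h
    obtain ⟨k, -, hk⟩ := Finset.exists_ne_zero_of_sum_ne_zero h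
    obtain ⟨e, rfl, rfl⟩ := exists_edge_of_ne_zero (right_ne_zero_of_mul hk)
    exact ⟨e, rfl, ih (left_ne_zero_of_mul hk)⟩

theorem startsChain_of_pow_ne_zero {N : ℕ} {i j : ι} (h : (A ^ N) i j ≠ 0) :
    EndsChain (E := Edge A) Edge.tgt Edge.src N i := by
  induction N generalizing i with
  | zero => trivial
  | succ N ih =>
    rw [pow_succ', Matrix.mul_apply] at h
    obtain ⟨k, -, hk⟩ := Finset.exists_ne_zero_of_sum_ne_zero h
    obtain ⟨e, rfl, rfl⟩ := exists_edge_of_ne_zero (left_ne_zero_of_mul hk)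
    exact ⟨e, rfl, ih (right_ne_zero_of_mul hk)⟩

/-- Restricting to the essential vertices preserves shift equivalence, because for large `N` the
matrix `A ^ N` has nonzero entries only from vertices with a future to vertices with a past. -/
theorem se_core (A : Matrix ι ι (MonoidAlgebra ℕ G)) : SE A (core A) := by
  classical
  obtain ⟨N₁, h₁⟩ := exists_forall_endsChain (E := Edge A) Edge.src Edge.tgt
  obtain ⟨N₂, h₂⟩ := exists_forall_endsChain (E := Edge A) Edge.tgt Edge.src
  set N := max 1 (max N₁ N₂) with hN
  have hpast : ∀ i j, (A ^ N) i j ≠ 0 → HasPast A j := fun i j h =>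
    h₁ j ((endsChain_of_pow_ne_zero h).of_le (by omega))
  have hfut : ∀ i j, (A ^ N) i j ≠ 0 → HasFuture A i := fun i j h =>
    h₂ i ((startsChain_of_pow_ne_zero h).of_le (by omega))
  set P : Matrix ι ι (MonoidAlgebra ℕ G) := Matrix.diagonal fun i => if HasPast A i then 1 else 0
    with hP
  set F : Matrix ι ι (MonoidAlgebra ℕ G) := Matrix.diagonal fun i => if HasFuture A i then 1 else 0
    with hF
  have hF' : F * A * F = A * F := by
    ext1 i j
    simp only [hF, Matrix.diagonal_mul, Matrix.mul_diagonal]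
    by_cases hj : HasFuture A j
    · by_cases hi : HasFuture A i
      · simp [hi]
      · have : A i j = 0 := by_contra fun h => hi (hj.of_ne_zero h)
        simp [this]
    · simp [hj]
  have hP' : P * A * P = P * A := by
    ext1 i j
    simp only [hP, Matrix.diagonal_mul, Matrix.mul_diagonal]
    by_cases hi : HasPast A i
    · by_cases hj : HasPast A j
      · simp [hj]
      · have : A i j = 0 := by_contra fun h => hj (hi.of_ne_zero h)
        simp [this]
    · simp [hi]
  have hAP : A ^ N * P = A ^ N := by
    ext1 i j
    simp only [hP, Matrix.mul_diagonal]
    by_cases hj : HasPast A j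
    · simp [hj]
    · have : (A ^ N) i j = 0 := by_contra fun h => hj (hpast i j h)
      simp [this]
  have hFA : F * A ^ N = A ^ N := by
    ext1 i j
    simp only [hF, Matrix.diagonal_mul]
    by_cases hi : HasFuture A i
    · simp [hi]
    · have : (A ^ N) i j = 0 := by_contra fun h => hi (hfut i j h)
      simp [this]
  have hcore : core A = P * A * F := by
    ext1 i j
    simp only [hP, hF, Matrix.diagonal_mul, Matrix.mul_diagonal, core, Matrix.of_apply]
    by_cases h0 : A i j = 0
    · simp [h0]
    by_cases hi : HasPast A i
    · by_cases hj : HasFuture A j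
      · have h1 : IsEssential A i :=
          isEssential_of_hasPast_of_hasFuture hi (hj.of_ne_zero h0)
        have h2 : IsEssential A j :=
          isEssential_of_hasPast_of_hasFuture (hi.of_ne_zero h0) hj
        simp [hi, hj, h1, h2]
      · have h2 : ¬ IsEssential A j := fun h => hj h.hasFuture
        simp [hj, h2]
    · have h1 : ¬ IsEssential A i := fun h => hi h.hasPast
      simp [hi, h1]
  rw [hcore]
  refine SE.of_trim (N := N) (by omega) ?_ ?_ hF' hP' hAP hFA
  · simp [hP, Matrix.diagonal_mul_diagonal]
  · rw [hP, hF, Matrix.diagonal_mul_diagonal, Matrix.diagonal_mul_diagonal]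
    congr 1
    funext i
    split_ifs <;> simp

end Core

/-! ### Counting equivalence classes -/

section Classes

variable {Y G ι κ ν : Type*}

/-- The classes of `S` in the `R`-class of `y` whose elements have state `t`. -/
def Classes (R S : Setoid Y) (s : Y → κ × G) (y : Y) (t : κ × G) : Type _ :=
  {q : Quotient S // ∃ y', R y' y ∧ ⟦y'⟧ = q ∧ s y' = t}

/-- Bijections of the ambient sets carry classes to classes. -/
def classesCongr {Y' κ' G' : Type*} {R S : Setoid Y} {R' S' : Setoid Y'} {s : Y → κ × G}
    {s' : Y' → κ' × G'} (E : Y ≃ Y') (hR : ∀ a b, R a b ↔ R' (E a) (E b))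
    (hS : ∀ a b, S a b ↔ S' (E a) (E b)) {t : κ × G} {t' : κ' × G'}
    (hs : ∀ a, s a = t ↔ s' (E a) = t') (y : Y) : Classes R S s y t ≃ Classes R' S' s' (E y) t' :=
  (Quotient.congr E hS).subtypeEquiv fun q => by
    constructor
    · rintro ⟨y', h1, rfl, h2⟩
      exact ⟨E y', (hR _ _).mp h1, rfl, (hs _).mp h2⟩
    · rintro ⟨y', h1, h2, h3⟩
      obtain ⟨y', rfl⟩ := E.surjective y'
      refine ⟨y', (hR _ _).mpr h1, ?_, (hs _).mpr h3⟩
      exact (Quotient.congr E hS).injective h2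

variable [Group G]

/-- The matrix `M` over `ℕ[G]` counts the classes of the finer relation `S` in a class of `R`: in the
`R`-class of a point with state `(i, g)`, the number of `S`-classes with state `(j, h)` is the
coefficient of `M i j` at `g⁻¹ * h`. -/
def Counts (R S : Setoid Y) (sR : Y → ι × G) (sS : Y → κ × G)
    (M : Matrix ι κ (MonoidAlgebra ℕ G)) : Prop :=
  ∀ y t, HasCard (Classes R S sS y t) ((M (sR y).1 t.1).coeff ((sR y).2⁻¹ * t.2))

/-- Counting in two stages multiplies the matrices. -/
theorem Counts.mul [Fintype G] [Fintype κ] {R S Q : Setoid Y} {sR : Y → ι × G} {sS : Y → κ × G}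
    {sQ : Y → ν × G} {M : Matrix ι κ (MonoidAlgebra ℕ G)} {P : Matrix κ ν (MonoidAlgebra ℕ G)}
    (hM : Counts R S sR sS M) (hP : Counts S Q sS sQ P) (hSR : S ≤ R) (hQS : Q ≤ S)
    (hsS : ∀ a b, S a b → sS a = sS b) : Counts R Q sR sQ (M * P) := by
  rintro y ⟨j, h⟩
  set g := (sR y).2 with hg
  let st : Quotient Q → κ × G := Quotient.lift sS fun a b hab => hsS a b (hQS hab)
  refine hasCard_coeff_mul (fun q => ((st q.1).1, g⁻¹ * (st q.1).2)) fun c a => ?_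
  have h1 : HasCard (Classes R S sS y (c, g * a)) ((M (sR y).1 c).coeff a) := by
    have := hM y (c, g * a)
    rwa [← hg, inv_mul_cancel_left] at this
  have hst : ∀ q : {q : Classes R Q sQ y (j, h) // ((st q.1).1, g⁻¹ * (st q.1).2) = (c, a)},
      st q.1.1 = (c, g * a) := fun q => by
    have h2 := q.2
    rw [Prod.mk.injEq] at h2
    exact Prod.ext h2.1 (eq_mul_of_inv_mul_eq h2.2)
  let toS : Quotient Q → Quotient S := Quotient.map' id fun a b hab => hQS hab
  refine HasCard.of_fibers_const (α := Classes R S sS y (c, g * a))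
    (fun q => ⟨toS q.1.1, ?_⟩) h1 ?_
  · obtain ⟨y', hy', hq, -⟩ := q.1.2
    refine ⟨y', hy', ?_, ?_⟩
    · rw [← hq]; rfl
    · rw [← hst q, ← hq]; rfl
  · rintro ⟨_, y', hy', rfl, hsy'⟩
    have h2 := hP y' (j, h)
    rw [hsy'] at h2
    simp only [mul_inv_rev, mul_assoc] at h2
    refine h2.of_equiv
      { toFun := fun q => ⟨⟨⟨q.1, ?_⟩, ?_⟩, ?_⟩
        invFun := fun q => ⟨q.1.1.1, ?_⟩
        left_inv := fun q => rfl
        right_inv := fun q => rfl }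
    · obtain ⟨z, hz, hq, hs⟩ := q.2
      exact ⟨z, R.trans (hSR hz) hy', hq, hs⟩
    · obtain ⟨z, hz, hq, hs⟩ := q.2
      have : st q.1 = (c, g * a) := by
        rw [← hq, ← hsy']; exact hsS _ _ hz
      simp [this]
    · obtain ⟨z, hz, hq, hs⟩ := q.2
      refine Subtype.ext ?_
      change toS q.1 = ⟦y'⟧
      rw [← hq]
      exact Quotient.sound hz
    · obtain ⟨z, hz, hq, hs⟩ := q.1.1.2
      have h3 : toS q.1.1.1 = ⟦y'⟧ := congrArg Subtype.val q.2
      rw [← hq] at h3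
      exact ⟨z, Quotient.exact h3, hq, hs⟩

/-- A counting matrix is unique on the rows that occur as states. -/
theorem Counts.unique {R S : Setoid Y} {sR : Y → ι × G} {sS : Y → κ × G}
    {M M' : Matrix ι κ (MonoidAlgebra ℕ G)} (hM : Counts R S sR sS M) (hM' : Counts R S sR sS M')
    (hrow : ∀ i, (∃ y, (sR y).1 = i) ∨ ∀ j, M i j = 0 ∧ M' i j = 0) : M = M' := by
  ext i j g
  rcases hrow i with ⟨y, rfl⟩ | h
  · have h1 := (hM y (j, (sR y).2 * g)).2
    have h2 := (hM' y (j, (sR y).2 * g)).2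
    rw [h1, inv_mul_cancel_left] at h2
    exact h2
  · rw [(h j).1, (h j).2]

end Classes

/-! ### Codings by bi-infinite paths -/

/-- A coding of a `G`-set `Y` by the bi-infinite paths in the graph of `A`, with positions in `G`:
each point of `Y` has an edge and a position at each time, and every path occurs with every position
at a given time. Different points may have the same edges and positions. -/
structure Coding {G ι : Type*} [Group G] (A : Matrix ι ι (MonoidAlgebra ℕ G)) (Y : Type*)
    [MulAction G Y] where
  /-- the edge at time `k` -/
  edge : Y → ℤ → Edge A
  /-- the position at time `k` -/
  pos : Y → ℤ → G
  tgt_edge : ∀ y k, (edge y k).tgt = (edge y (k + 1)).src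
  pos_add_one : ∀ y k, pos y (k + 1) = pos y k * (edge y k).label
  edge_smul : ∀ (g : G) y, edge (g • y) = edge y
  pos_smul : ∀ (g : G) y k, pos (g • y) k = g * pos y k
  exists_of_path : ∀ x : ℤ → Edge A, (∀ k, (x k).tgt = (x (k + 1)).src) →
    ∀ m g, ∃ y, edge y = x ∧ pos y m = g

namespace Coding

variable {G ι : Type*} [Group G] {A : Matrix ι ι (MonoidAlgebra ℕ G)} {Y : Type*} [MulAction G Y]
  (c : Coding A Y)

/-- Edge and position at time `k`. -/
def coord (y : Y) (k : ℤ) : Edge A × G := (c.edge y k, c.pos y k)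

/-- Vertex and position at time `k`. -/
def state (k : ℤ) (y : Y) : ι × G := ((c.edge y k).src, c.pos y k)

/-- Two points are related if they agree at all times before `m`. -/
def past (m : ℤ) : Setoid Y where
  r y y' := ∀ k < m, c.coord y k = c.coord y' k
  iseqv := ⟨fun _ _ _ => rfl, fun h k hk => (h k hk).symm,
    fun h h' k hk => (h k hk).trans (h' k hk)⟩

theorem past_le {m n : ℤ} (h : m ≤ n) : c.past n ≤ c.past m :=
  fun _ _ hab k hk => hab k (hk.trans_le h)

theorem state_eq_of_past {m : ℤ} {y y' : Y} (h : c.past m y y') : c.state m y = c.state m y' := by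
  have h1 := h (m - 1) (by omega)
  simp only [coord, Prod.mk.injEq] at h1
  have h2 := c.tgt_edge y (m - 1)
  have h3 := c.tgt_edge y' (m - 1)
  have h4 := c.pos_add_one y (m - 1)
  have h5 := c.pos_add_one y' (m - 1)
  rw [sub_add_cancel] at h2 h3 h4 h5
  exact Prod.ext (by rw [state, state, ← h2, ← h3, h1.1]) (by rw [state, state, h4, h5, h1.1, h1.2])

theorem pos_eq_of_le {y y' : Y} {m : ℤ} (he : ∀ k < m, c.edge y k = c.edge y' k)
    (hm : c.pos y m = c.pos y' m) {k : ℤ} (hk : k ≤ m) : c.pos y k = c.pos y' k := by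
  induction k, hk using Int.leInductionDown with
  | base => exact hm
  | pred k hk ih =>
    have h1 := c.pos_add_one y (k - 1)
    have h2 := c.pos_add_one y' (k - 1)
    rw [sub_add_cancel] at h1 h2
    rw [h1, h2, he _ (by omega)] at ih
    exact mul_right_cancel ih

theorem pos_eq_of_ge {y y' : Y} {m : ℤ} (he : ∀ k ≥ m, c.edge y k = c.edge y' k)
    (hm : c.pos y m = c.pos y' m) {k : ℤ} (hk : m ≤ k) : c.pos y k = c.pos y' k := by
  induction k, hk using Int.leInduction with
  | base => exact hm
  | succ k hk ih => rw [c.pos_add_one, c.pos_add_one, ih, he _ hk]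

/-- The past of `y` can be continued by the future of `y'` if their states at time `m` agree. -/
theorem exists_glue {y y' : Y} {m : ℤ} (h : c.state m y = c.state m y') :
    ∃ w, c.past m w y ∧ ∀ k ≥ m, c.coord w k = c.coord y' k := by
  simp only [state, Prod.mk.injEq] at h
  obtain ⟨w, hw, hm⟩ := c.exists_of_path
    (fun k => if k < m then c.edge y k else c.edge y' k) (fun k => by
      by_cases h1 : k + 1 < m
      · rw [if_pos h1, if_pos (by omega)]; exact c.tgt_edge y k
      · by_cases h2 : k < m
        · obtain rfl : m = k + 1 := by omega
          rw [if_pos h2, if_neg h1, c.tgt_edge, h.1]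
        · rw [if_neg h1, if_neg h2]; exact c.tgt_edge y' k) m (c.pos y m)
  have h1 : ∀ k < m, c.edge w k = c.edge y k := fun k hk => by rw [hw]; exact if_pos hk
  have h2 : ∀ k ≥ m, c.edge w k = c.edge y' k := fun k hk => by
    rw [hw]; exact if_neg (by omega)
  exact ⟨w, fun k hk => Prod.ext (h1 k hk) (c.pos_eq_of_le h1 hm hk.le),
    fun k hk => Prod.ext (h2 k hk) (c.pos_eq_of_ge h2 (hm.trans h.2) hk)⟩

theorem isEssential_src (y : Y) (k : ℤ) : IsEssential A (c.edge y k).src :=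
  ⟨⟨fun l => c.edge y (k + l), fun l => by rw [c.tgt_edge, add_assoc]⟩, by simp⟩

theorem exists_state {i : ι} (h : IsEssential A i) (m : ℤ) (g : G) :
    ∃ y, c.state m y = (i, g) := by
  obtain ⟨x, rfl⟩ := h
  obtain ⟨y, hy, hg⟩ := c.exists_of_path (fun k => x.1 (k - m))
    (fun k => by rw [x.2]; exact congrArg (fun l => (x.1 l).src) (by ring)) m g
  exact ⟨y, Prod.ext (by simp [state, hy]) hg⟩

/-- The past of `y` can be continued by every edge with an essential target. -/
theorem exists_extend {y : Y} {m : ℤ} {e : Edge A} (he : (c.edge y m).src = e.src)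
    (ht : IsEssential A e.tgt) : ∃ w, c.past m w y ∧ c.edge w m = e := by
  obtain ⟨x, hx⟩ := ht
  obtain ⟨y', hy', hm⟩ := c.exists_of_path
    (fun k => if k < m then c.edge y k else if k = m then e else x.1 (k - m - 1)) (fun k => by
      rcases lt_trichotomy (k + 1) m with h1 | h1 | h1
      · rw [if_pos h1, if_pos (by omega)]; exact c.tgt_edge y k
      · rw [if_pos (by omega), if_neg (by omega), if_pos h1, c.tgt_edge, h1, he]
      · by_cases h2 : k = m
        · subst h2
          rw [if_neg (lt_irrefl k), if_pos rfl, if_neg (show ¬ k + 1 < k by omega),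
            if_neg (show ¬ k + 1 = k by omega), ← hx]
          exact congrArg (fun l => (x.1 l).src) (by ring)
        · rw [if_neg (show ¬ k < m by omega), if_neg h2, if_neg (show ¬ k + 1 < m by omega),
            if_neg (show ¬ k + 1 = m by omega), x.2]
          exact congrArg (fun l => (x.1 l).src) (by ring)) m (c.pos y m)
  have h1 : ∀ k < m, c.edge y' k = c.edge y k := fun k hk => by rw [hy']; exact if_pos hk
  refine ⟨y', fun k hk => Prod.ext (h1 k hk) (c.pos_eq_of_le h1 hm hk.le), ?_⟩
  rw [hy']
  simp

/-- One more time step is counted by the core of `A`. -/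
theorem counts_core (m : ℤ) :
    Counts (c.past m) (c.past (m + 1)) (c.state m) (c.state (m + 1)) (core A) := by
  rintro y ⟨j, h⟩
  have hi := c.isEssential_src y m
  by_cases hj : IsEssential A j
  · have hcore : core A (c.state m y).1 j = A (c.edge y m).src j := by
      simp only [core, Matrix.of_apply]
      exact if_pos ⟨hi, hj⟩
    rw [hcore]
    have hex : ∀ e : {e : Edge A // e.data = ((c.edge y m).src, j, (c.pos y m)⁻¹ * h)},
        ∃ w, c.past m w y ∧ c.edge w m = e.1 := fun e => by
      have he := e.2
      simp only [Edge.data, Prod.mk.injEq] at he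
      exact c.exists_extend he.1.symm (by rw [he.2.1]; exact hj)
    choose w hw hwe using hex
    have hstate : ∀ e, c.state (m + 1) (w e) = (j, h) := fun e => by
      have he := e.2
      simp only [Edge.data, Prod.mk.injEq] at he
      have h1 := congrArg Prod.snd (c.state_eq_of_past (hw e))
      simp only [state] at h1
      refine Prod.ext ?_ ?_
      · change (c.edge (w e) (m + 1)).src = j
        rw [← c.tgt_edge, hwe, he.2.1]
      · change c.pos (w e) (m + 1) = h
        rw [c.pos_add_one, h1, hwe, he.2.2, mul_inv_cancel_left]
    refine (Edge.hasAdjacency A _ j _).of_equiv (Equiv.ofBijective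
      (fun e => (⟨⟦w e⟧, w e, hw e, rfl, hstate e⟩ : Classes _ _ _ y (j, h))) ⟨?_, ?_⟩)
    · intro e e' hee
      have h1 : c.past (m + 1) (w e) (w e') := Quotient.exact (congrArg Subtype.val hee)
      have h2 := congrArg Prod.fst (h1 m (by omega))
      refine Subtype.ext ?_
      exact (hwe e).symm.trans (h2.trans (hwe e'))
    · rintro ⟨_, y', hy', rfl, hs⟩
      have h0 := c.state_eq_of_past hy'
      simp only [state, Prod.mk.injEq] at h0 hs
      have h1 := c.pos_add_one y' m
      have hdata : (c.edge y' m).data = ((c.edge y m).src, j, (c.pos y m)⁻¹ * h) := by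
        refine Prod.ext h0.1 (Prod.ext ((c.tgt_edge y' m).trans hs.1) ?_)
        rw [← hs.2, h1, h0.2]
        exact (inv_mul_cancel_left _ _).symm
      refine ⟨⟨c.edge y' m, hdata⟩, Subtype.ext (Quotient.sound ?_)⟩
      have h2 := (c.past m).trans (hw ⟨c.edge y' m, hdata⟩) ((c.past m).symm hy')
      have h3 := congrArg Prod.snd (c.state_eq_of_past h2)
      intro k hk
      rcases (Int.lt_add_one_iff.mp hk).lt_or_eq with hk' | rfl
      · exact h2 k hk'
      · exact Prod.ext (hwe _) h3
  · have hcore : core A (c.state m y).1 j = 0 := by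
      simp only [core, Matrix.of_apply]
      exact if_neg fun hh => hj hh.2
    rw [hcore]
    have : IsEmpty (Classes (c.past m) (c.past (m + 1)) (c.state (m + 1)) y (j, h)) := by
      refine ⟨?_⟩
      rintro ⟨_, y', -, -, hs⟩
      have h1 := c.isEssential_src y' (m + 1)
      have h2 : (c.edge y' (m + 1)).src = j := congrArg Prod.fst hs
      exact hj (h2 ▸ h1)
    exact ⟨inferInstance, Nat.card_of_isEmpty⟩

theorem counts_core_pow [Fintype G] [Fintype ι] [DecidableEq ι] (m : ℤ) {n : ℕ} (hn : 1 ≤ n) :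
    Counts (c.past m) (c.past (m + n)) (c.state m) (c.state (m + n)) (core A ^ n) := by
  induction n, hn using Nat.le_induction with
  | base => simpa using c.counts_core m
  | succ n hn ih =>
    rw [pow_succ]
    have h : m + ((n + 1 : ℕ) : ℤ) = m + n + 1 := by push_cast; ring
    rw [h]
    exact ih.mul (c.counts_core _) (c.past_le (by omega)) (c.past_le (by omega))
      fun a b hab => c.state_eq_of_past hab

end Coding

/-! ### Two codings that determine each other -/

namespace Coding

variable {G ι κ : Type*} [Group G] {A : Matrix ι ι (MonoidAlgebra ℕ G)}
  {B : Matrix κ κ (MonoidAlgebra ℕ G)} {Y : Type*} [MulAction G Y]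

theorem past_translate (c : Coding A Y) {s : ℤ} {E : Y ≃ Y}
    (hc : ∀ y k, c.coord (E y) k = c.coord y (k + s)) (m : ℤ) (y y' : Y) :
    c.past (m + s) y y' ↔ c.past m (E y) (E y') := by
  constructor
  · intro hy l hl
    rw [hc, hc]
    exact hy _ (by omega)
  · intro hy l hl
    have := hy (l - s) (by omega)
    rwa [hc, hc, sub_add_cancel] at this

theorem state_translate (c : Coding A Y) {s : ℤ} {E : Y ≃ Y}
    (hc : ∀ y k, c.coord (E y) k = c.coord y (k + s)) (m : ℤ) (y : Y) :
    c.state (m + s) y = c.state m (E y) := by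
  have h := hc y m
  simp only [coord, Prod.mk.injEq] at h
  exact Prod.ext (congrArg Edge.src h.1.symm) h.2.symm

theorem counts_translate {c : Coding A Y} {d : Coding B Y} {m n s : ℤ} {E : Y ≃ Y}
    (hc : ∀ y k, c.coord (E y) k = c.coord y (k + s))
    (hd : ∀ y k, d.coord (E y) k = d.coord y (k + s)) {U : Matrix ι κ (MonoidAlgebra ℕ G)}
    (h : Counts (c.past m) (d.past n) (c.state m) (d.state n) U) :
    Counts (c.past (m + s)) (d.past (n + s)) (c.state (m + s)) (d.state (n + s)) U := by
  intro y t
  rw [c.state_translate hc]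
  exact (h (E y) t).of_equiv (classesCongr E (c.past_translate hc m) (d.past_translate hd n)
    (fun a => by rw [d.state_translate hd]) y).symm

theorem past_smul (c : Coding A Y) (g : G) (m : ℤ) (y y' : Y) :
    c.past m y y' ↔ c.past m (g • y) (g • y') := by
  refine forall₂_congr fun k _ => ?_
  simp [coord, c.edge_smul, c.pos_smul]

/-- The coding `c` determines the coding `d` with the window `[-N, N]`. -/
def Determines (c : Coding A Y) (d : Coding B Y) (N : ℕ) : Prop :=
  ∀ y y' m, (∀ k : ℤ, m - N ≤ k → k ≤ m + N → c.coord y k = c.coord y' k) →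
    d.coord y m = d.coord y' m

theorem Determines.mono {c : Coding A Y} {d : Coding B Y} {N N' : ℕ} (h : Determines c d N)
    (hN : N ≤ N') : Determines c d N' := fun y y' m hy =>
  h y y' m fun k hk hk' => hy k (by omega) (by omega)

theorem Determines.past_le {c : Coding A Y} {d : Coding B Y} {N : ℕ} (h : Determines c d N)
    {m n : ℤ} (hmn : m + N ≤ n) : c.past n ≤ d.past m := fun y y' hy k hk =>
  h y y' k fun l _ hl => hy l (by omega)

theorem finite_classes [Finite G] [Fintype κ] [DecidableEq κ] {c : Coding A Y} {d : Coding B Y}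
    {N b : ℕ} (hcd : Determines c d N) (hb : 1 ≤ b) (y : Y) (t : κ × G) :
    Finite (Classes (c.past 0) (d.past b) (d.state b) y t) := by
  have := Fintype.ofFinite G
  have h := (d.counts_core_pow (-N) (n := b + N) (by omega) y t).1
  have hbN : -(N : ℤ) + ((b + N : ℕ) : ℤ) = b := by push_cast; ring
  rw [hbN] at h
  refine Finite.of_injective (β := Classes (d.past (-N)) (d.past b) (d.state b) y t)
    (fun q => ⟨q.1, ?_⟩) fun q q' hq => by
      have hqq := congrArg Subtype.val hq
      exact Subtype.ext hqq
  obtain ⟨y', h1, h2, h3⟩ := q.2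
  exact ⟨y', hcd.past_le (by omega) h1, h2, h3⟩

/-- Replacing the `c`-past before time `0` of two points with a common `c`-past by another one does
not affect whether their `d`-pasts before time `b` agree: the coordinates of `d` before `N` depend
only on the coordinates of `c` before `2 * N ≤ b - N`, and the later ones are unchanged. -/
theorem past_of_glue {c : Coding A Y} {d : Coding B Y} {N b : ℕ} (hcd : Determines c d N)
    (hdc : Determines d c N) (hb : 3 * N ≤ b) {v w v' w' : Y} (hvw : c.past 0 v w)
    (hv : ∀ k ≥ 0, c.coord v' k = c.coord v k) (hw : ∀ k ≥ 0, c.coord w' k = c.coord w k)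
    (h : d.past b v' w') : d.past b v w := by
  have h1 : c.past (b - N) v w := fun k hk => by
    by_cases hk0 : k < 0
    · exact hvw k hk0
    · rw [← hv k (by omega), ← hw k (by omega)]
      exact hdc.past_le (m := b - N) (by omega) h k hk
  intro k hk
  by_cases hkN : k < N
  · exact hcd.past_le (m := N) (by omega) h1 k hkN
  · rw [← hcd v' v k fun l hl _ => hv l (by omega), ← hcd w' w k fun l hl _ => hw l (by omega)]
    exact h k hk

/-- The number of `d`-classes within a `c`-class does not depend on the past of the `c`-class:
representatives keep their future and are given another past. -/
theorem card_classes_le [Finite G] [Fintype κ] [DecidableEq κ] {c : Coding A Y} {d : Coding B Y}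
    {N b : ℕ} (hcd : Determines c d N) (hdc : Determines d c N) (hb : 3 * N ≤ b) (hb1 : 1 ≤ b)
    {y y' : Y} (hy : c.state 0 y = c.state 0 y') (t : κ × G) :
    Nat.card (Classes (c.past 0) (d.past b) (d.state b) y t) ≤
      Nat.card (Classes (c.past 0) (d.past b) (d.state b) y' t) := by
  have := finite_classes hcd hb1 y' t
  have hex : ∀ q : Classes (c.past 0) (d.past b) (d.state b) y t,
      ∃ v v', c.past 0 v y ∧ ⟦v⟧ = q.1 ∧ c.past 0 v' y' ∧ d.state b v' = t ∧
        ∀ k ≥ 0, c.coord v' k = c.coord v k := by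
    rintro ⟨_, v, hv, rfl, hs⟩
    obtain ⟨v', hv', hfut⟩ := c.exists_glue (hy.symm.trans (c.state_eq_of_past hv).symm)
    refine ⟨v, v', hv, rfl, hv', ?_, hfut⟩
    have h := hcd v' v b fun l hl _ => hfut l (by omega)
    simp only [coord, Prod.mk.injEq] at h
    rw [← hs]
    exact Prod.ext (congrArg Edge.src h.1) h.2
  choose v v' hv hq hv' hs hfut using hex
  refine Nat.card_le_card_of_injective (fun q => ⟨⟦v' q⟧, v' q, hv' q, rfl, hs q⟩) ?_
  intro q q' hqq
  have h1 : d.past b (v' q) (v' q') := Quotient.exact (congrArg Subtype.val hqq)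
  refine Subtype.ext ?_
  rw [← hq, ← hq]
  exact Quotient.sound (past_of_glue hcd hdc hb ((c.past 0).trans (hv q) ((c.past 0).symm (hv q')))
    (hfut q) (hfut q') h1)

/-- If two codings determine each other, the classes of one in those of the other are counted by a
matrix over `ℕ[G]`. -/
theorem exists_counts [Finite G] [Fintype κ] [DecidableEq κ] {c : Coding A Y} {d : Coding B Y}
    {N b : ℕ} (hcd : Determines c d N) (hdc : Determines d c N) (hb : 3 * N ≤ b) (hb1 : 1 ≤ b) :
    ∃ U : Matrix ι κ (MonoidAlgebra ℕ G),
      Counts (c.past 0) (d.past b) (c.state 0) (d.state b) U ∧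
        ∀ i, ¬ IsEssential A i → ∀ j, U i j = 0 := by
  classical
  choose y hy using fun i : {i // IsEssential A i} => c.exists_state i.2 0 1
  refine ⟨Matrix.of fun i j => if h : IsEssential A i then MonoidAlgebra.ofCoeff
    (Finsupp.equivFunOnFinite.symm fun g =>
      Nat.card (Classes (c.past 0) (d.past b) (d.state b) (y ⟨i, h⟩) (j, g))) else 0,
    ?_, fun i hi j => dif_neg hi⟩
  rintro z ⟨j, h⟩
  have hi := c.isEssential_src z 0
  have hU : (Matrix.of (fun i j => if h : IsEssential A i then MonoidAlgebra.ofCoeff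
      (Finsupp.equivFunOnFinite.symm fun g =>
        Nat.card (Classes (c.past 0) (d.past b) (d.state b) (y ⟨i, h⟩) (j, g))) else 0)
      (c.state 0 z).1 j).coeff ((c.state 0 z).2⁻¹ * h) =
      Nat.card (Classes (c.past 0) (d.past b) (d.state b) (y ⟨_, hi⟩)
        (j, (c.state 0 z).2⁻¹ * h)) := by
    simp only [Matrix.of_apply]
    rw [dif_pos (show IsEssential A (c.state 0 z).1 from hi)]
    rfl
  rw [hU]
  refine ⟨finite_classes hcd hb1 _ _, ?_⟩
  set g := (c.state 0 z).2 with hg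
  -- by equivariance the class of `z` may be moved to position `1`, where `y` was chosen
  rw [Nat.card_congr (classesCongr (MulAction.toPerm g⁻¹) (c.past_smul g⁻¹ 0) (d.past_smul g⁻¹ b)
    (t' := (j, g⁻¹ * h)) (s' := d.state b) (fun a => ?_) z)]
  · have hst : c.state 0 (g⁻¹ • z) = c.state 0 (y ⟨_, hi⟩) := by
      rw [hy]
      refine Prod.ext ?_ ?_
      · simp [state, c.edge_smul]
      · simp [state, c.pos_smul, hg]
    exact le_antisymm (card_classes_le hcd hdc hb hb1 hst _)
      (card_classes_le hcd hdc hb hb1 hst.symm _)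
  · simp [state, d.edge_smul, d.pos_smul, Prod.ext_iff]

theorem core_pow_apply_eq_zero [Fintype ι] [DecidableEq ι] {k : ℕ} (hk : 1 ≤ k) {i : ι}
    (hi : ¬ IsEssential A i) (j : ι) : (core A ^ k) i j = 0 := by
  obtain ⟨k, rfl⟩ : ∃ k', k = k' + 1 := ⟨k - 1, by omega⟩
  rw [pow_succ', Matrix.mul_apply]
  refine Finset.sum_eq_zero fun l _ => ?_
  have h : core A i l = 0 := if_neg fun h => hi h.1
  rw [h, zero_mul]

/-- Matrices counting classes over pasts coincide if their inessential rows vanish. -/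
theorem counts_unique {c : Coding A Y} {m : ℤ} {S : Setoid Y} {sS : Y → κ × G}
    {M M' : Matrix ι κ (MonoidAlgebra ℕ G)} (hM : Counts (c.past m) S (c.state m) sS M)
    (hM' : Counts (c.past m) S (c.state m) sS M')
    (h0 : ∀ i, ¬ IsEssential A i → ∀ j, M i j = 0)
    (h0' : ∀ i, ¬ IsEssential A i → ∀ j, M' i j = 0) : M = M' := by
  refine hM.unique hM' fun i => ?_
  by_cases hi : IsEssential A i
  · obtain ⟨y, hy⟩ := c.exists_state hi m 1
    exact Or.inl ⟨y, congrArg Prod.fst hy⟩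
  · exact Or.inr fun j => ⟨h0 i hi j, h0' i hi j⟩

theorem mul_apply_eq_zero {S α β γ : Type*} [Semiring S] [Fintype β] {M : Matrix α β S}
    {P : Matrix β γ S} {i : α} (h : ∀ j, M i j = 0) (k : γ) : (M * P) i k = 0 := by
  rw [Matrix.mul_apply]
  exact Finset.sum_eq_zero fun j _ => by rw [h, zero_mul]

section Relations

variable [Finite G] [Fintype ι] [DecidableEq ι] [Fintype κ]
  {c : Coding A Y} {d : Coding B Y} {N b : ℕ} {U : Matrix ι κ (MonoidAlgebra ℕ G)}

/-- Counting from `c` to `d` and back to `c` amounts to counting from `c` to a later time. -/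
theorem core_pow_eq_mul (hcd : Determines c d N) (hdc : Determines d c N) (hb : N ≤ b) (hb1 : 1 ≤ b)
    {V : Matrix κ ι (MonoidAlgebra ℕ G)}
    (hU : Counts (c.past 0) (d.past b) (c.state 0) (d.state b) U)
    (hU0 : ∀ i, ¬ IsEssential A i → ∀ j, U i j = 0)
    (hV : Counts (d.past b) (c.past (b + b)) (d.state b) (c.state (b + b)) V) :
    core A ^ (b + b) = U * V := by
  have := Fintype.ofFinite G
  have h1 := c.counts_core_pow 0 (n := b + b) (by omega)
  rw [zero_add, Nat.cast_add] at h1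
  exact counts_unique h1 (hU.mul hV (hdc.past_le (by omega)) (hcd.past_le (by omega))
    fun _ _ h => d.state_eq_of_past h) (fun i hi j => core_pow_apply_eq_zero (by omega) hi j)
    fun i hi j => mul_apply_eq_zero (hU0 i hi) j

variable [DecidableEq κ]

/-- The classes of `d` at time `b + n` in those of `c` at time `0` can be counted via `c` at time `n`
or via `d` at time `b`. -/
theorem core_pow_mul_eq {n : ℕ} (hn : 1 ≤ n) (hdc : Determines d c N) (hb : N ≤ b)
    (hU : Counts (c.past 0) (d.past b) (c.state 0) (d.state b) U)
    (hU0 : ∀ i, ¬ IsEssential A i → ∀ j, U i j = 0)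
    (hU' : Counts (c.past n) (d.past (b + n)) (c.state n) (d.state (b + n)) U) :
    core A ^ n * U = U * core B ^ n := by
  have := Fintype.ofFinite G
  have h1 := c.counts_core_pow 0 hn
  rw [zero_add] at h1
  exact counts_unique
    (h1.mul hU' (c.past_le (by omega)) (hdc.past_le (by omega)) fun _ _ h => c.state_eq_of_past h)
    (hU.mul (d.counts_core_pow b hn) (hdc.past_le (by omega)) (d.past_le (by omega))
      fun _ _ h => d.state_eq_of_past h)
    (fun i hi j => mul_apply_eq_zero (core_pow_apply_eq_zero hn hi) j)
    fun i hi j => mul_apply_eq_zero (hU0 i hi) j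

/-- The cores of matrices with codings that determine each other have shift equivalent `n`-th
powers, if translations by multiples of `n` are realized by the same bijections of the space in both
codings. -/
theorem se_core_pow {n : ℕ} (hn : 1 ≤ n) (hcd : Determines c d N) (hdc : Determines d c N)
    (hE : ∀ k : ℕ, ∃ E : Y ≃ Y, (∀ y l, c.coord (E y) l = c.coord y (l + (n * k : ℕ))) ∧
      ∀ y l, d.coord (E y) l = d.coord y (l + (n * k : ℕ))) :
    SE (core A ^ n) (core B ^ n) := by
  -- the time lag `b` is a multiple of `n`, so that a translation by `b` is available, and is large
  -- enough to exchange pasts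
  set p : ℕ := 3 * N + 1 with hp
  set b : ℕ := n * p with hb
  have hpb : p ≤ b := Nat.le_mul_of_pos_left _ hn
  obtain ⟨U, hU, hU0⟩ := exists_counts hcd hdc (b := b) (by omega) (by omega)
  obtain ⟨V, hV, hV0⟩ := exists_counts hdc hcd (b := b) (by omega) (by omega)
  obtain ⟨E, hEc, hEd⟩ := hE p
  obtain ⟨E₁, hE₁c, hE₁d⟩ := hE 1
  rw [mul_one] at hE₁c hE₁d
  have hUb := counts_translate hEc hEd hU
  have hVb := counts_translate hEd hEc hV
  have hU1 := counts_translate hE₁c hE₁d hU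
  have hV1 := counts_translate hE₁d hE₁c hV
  rw [zero_add] at hUb hVb hU1 hV1
  have hpow : n * (p + p) = b + b := by rw [mul_add]
  refine ⟨p + p, by omega, U, V, ?_, ?_, ?_, ?_⟩
  · rw [← pow_mul, hpow]
    exact core_pow_eq_mul hcd hdc (by omega) (by omega) hU hU0 hVb
  · rw [← pow_mul, hpow]
    exact core_pow_eq_mul hdc hcd (by omega) (by omega) hV hV0 hUb
  · exact core_pow_mul_eq hn hdc (by omega) hU hU0 hU1
  · exact core_pow_mul_eq hn hcd (by omega) hV hV0 hV1

end Relations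

end Coding

/-! ### From conjugacy of powers to shift equivalence -/

/-- On a compact space with continuous discrete coordinates that separate points, a continuous
function with discrete values depends on finitely many coordinates. -/
theorem exists_finite_window {X D D' : Type*} [TopologicalSpace X] [CompactSpace X]
    [TopologicalSpace D] [DiscreteTopology D] [TopologicalSpace D'] [DiscreteTopology D']
    {a : X → ℤ → D} (ha : ∀ k, Continuous fun x => a x k) (hinj : Function.Injective a)
    {f : X → D'} (hf : Continuous f) :
    ∃ N : ℕ, ∀ x x', (∀ k : ℤ, -N ≤ k → k ≤ N → a x k = a x' k) → f x = f x' := by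
  by_contra hno
  push Not at hno
  -- the pairs that agree on `[-N, N]` but have different values form nested compact sets
  let K : ℕ → Set (X × X) := fun N =>
    (⋂ k : ℤ, ⋂ _ : -(N : ℤ) ≤ k ∧ k ≤ N, {p | a p.1 k = a p.2 k}) ∩ {p | f p.1 ≠ f p.2}
  have hclosed : ∀ N, IsClosed (K N) := fun N => by
    refine IsClosed.inter (isClosed_iInter fun k => isClosed_iInter fun _ => ?_) ?_
    · exact isClosed_eq ((ha k).comp continuous_fst) ((ha k).comp continuous_snd)
    · have hc : Continuous fun p : X × X => (f p.1, f p.2) :=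
        (hf.comp continuous_fst).prodMk (hf.comp continuous_snd)
      exact (isClosed_discrete {q : D' × D' | q.1 ≠ q.2}).preimage hc
  obtain ⟨⟨x, x'⟩, hx⟩ := IsCompact.nonempty_iInter_of_sequence_nonempty_isCompact_isClosed K
    (fun N p hp => by
      refine ⟨Set.mem_iInter₂.mpr fun k hk => ?_, hp.2⟩
      exact Set.mem_iInter₂.mp hp.1 k ⟨by push_cast; omega, by push_cast; omega⟩)
    (fun N => by
      obtain ⟨x, x', h1, h2⟩ := hno N
      exact ⟨(x, x'), Set.mem_iInter₂.mpr fun k hk => h1 k hk.1 hk.2, h2⟩)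
    (hclosed 0).isCompact hclosed
  rw [Set.mem_iInter] at hx
  refine (hx 0).2 (congrArg f (hinj (funext fun k => ?_)))
  exact Set.mem_iInter₂.mp (hx k.natAbs).1 k ⟨by omega, by omega⟩

section Extension

variable {G ι κ : Type*} [Group G] [TopologicalSpace G] [DiscreteTopology G]

/-- The extension of an edge shift is coded by its edges and positions. -/
def extensionCoding (A : Matrix ι ι (MonoidAlgebra ℕ G)) :
    Coding A (ExtSpace (EdgeShift A) G) where
  edge z := z.1.1
  pos := pos
  tgt_edge z := z.1.2
  pos_add_one := pos_add_one
  edge_smul _ _ := rfl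
  pos_smul := pos_smul
  exists_of_path x hx m g := by
    obtain ⟨z, hz, hm⟩ := exists_of_path (A := A) ⟨x, hx⟩ m g
    exact ⟨z, congrArg Subtype.val hz, hm⟩

/-- Codings are transported along equivariant bijections. -/
def Coding.pullback {A : Matrix ι ι (MonoidAlgebra ℕ G)} {Y Y' : Type*} [MulAction G Y]
    [MulAction G Y'] (c : Coding A Y') (e : Y ≃ Y') (he : ∀ (g : G) y, e (g • y) = g • e y) :
    Coding A Y where
  edge y := c.edge (e y)
  pos y := c.pos (e y)
  tgt_edge y := c.tgt_edge (e y)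
  pos_add_one y := c.pos_add_one (e y)
  edge_smul g y := by rw [he, c.edge_smul]
  pos_smul g y := by rw [he]; exact c.pos_smul g (e y)
  exists_of_path x hx m g := by
    obtain ⟨z, hz, hm⟩ := c.exists_of_path x hx m g
    exact ⟨e.symm z, by rwa [e.apply_symm_apply], by rwa [e.apply_symm_apply]⟩

variable {A : Matrix ι ι (MonoidAlgebra ℕ G)} {B : Matrix κ κ (MonoidAlgebra ℕ G)}

theorem coord_zpow (z : ExtSpace (EdgeShift A) G) (n k : ℤ) :
    (extensionCoding A).coord ((extension A ^ n) z) k = (extensionCoding A).coord z (k + n) :=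
  Prod.ext (zpow_extension_fst n z k) (pos_zpow n z k)

theorem continuous_coord (k : ℤ) :
    Continuous fun z : ExtSpace (EdgeShift A) G => (extensionCoding A).coord z k :=
  (continuous_edge k).prodMk (continuous_pos k)

theorem coord_injective : Function.Injective (extensionCoding A).coord := fun z z' h =>
  ext_of_coords (fun k => congrArg Prod.fst (congrFun h k)) (by
    have := congrArg Prod.snd (congrFun h 0)
    simpa [Coding.coord, extensionCoding, pos_zero] using this)

theorem commute_zpow {φ : ExtSpace (EdgeShift A) G ≃ₜ ExtSpace (EdgeShift B) G} {n : ℕ}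
    (h : ∀ z, φ ((extension A ^ n) z) = (extension B ^ n) (φ z)) (k : ℤ)
    (z : ExtSpace (EdgeShift A) G) :
    φ ((extension A ^ (n * k : ℤ)) z) = (extension B ^ (n * k : ℤ)) (φ z) := by
  rw [zpow_mul, zpow_mul, zpow_natCast, zpow_natCast]
  induction k generalizing z with
  | zero => rfl
  | succ k ih => rw [zpow_add_one, zpow_add_one, Homeomorph.mul_apply, Homeomorph.mul_apply, ih, h]
  | pred k ih =>
    rw [zpow_sub_one, zpow_sub_one, Homeomorph.mul_apply, Homeomorph.mul_apply, ih]
    congr 1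
    apply (extension B ^ n).injective
    rw [← h, ← Homeomorph.mul_apply, ← Homeomorph.mul_apply, mul_inv_cancel, mul_inv_cancel]
    rfl

/-- A conjugacy of the `n`-th powers is a sliding block map: the coordinates of the image are
determined within a window of bounded size. -/
theorem exists_window [Finite G] [Finite ι]
    {φ : ExtSpace (EdgeShift A) G ≃ₜ ExtSpace (EdgeShift B) G} {n : ℕ} (hn : 1 ≤ n)
    (h : ∀ z, φ ((extension A ^ n) z) = (extension B ^ n) (φ z)) :
    ∃ N : ℕ, ∀ z z' m,
      (∀ k : ℤ, m - N ≤ k → k ≤ m + N →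
        (extensionCoding A).coord z k = (extensionCoding A).coord z' k) →
      (extensionCoding B).coord (φ z) m = (extensionCoding B).coord (φ z') m := by
  have := compactSpace_extSpace A
  have hf : Continuous fun z (s : Fin n) => (extensionCoding B).coord (φ z) (s : ℕ) :=
    continuous_pi fun s => (continuous_coord _).comp φ.continuous
  obtain ⟨N, hN⟩ := exists_finite_window continuous_coord coord_injective hf
  refine ⟨N + n, fun z z' m hm => ?_⟩
  have hn0 : (0 : ℤ) < n := by exact_mod_cast hn
  have h0 := Int.emod_nonneg m hn0.ne'
  have h1 := Int.emod_lt_of_pos m hn0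
  have h2 : m % n + n * (m / n) = m := Int.emod_add_mul_ediv m n
  -- translate the time `m` to its remainder modulo `n`
  have key := hN ((extension A ^ (n * (m / n) : ℤ)) z) ((extension A ^ (n * (m / n) : ℤ)) z')
    fun k hk hk' => by
      rw [coord_zpow, coord_zpow]
      exact hm _ (by push_cast; omega) (by push_cast; omega)
  have h3 := congrFun key ⟨(m % n).toNat, by omega⟩
  simp only [commute_zpow h, coord_zpow, Int.toNat_of_nonneg h0, h2] at h3
  exact h3

/-- A `G`-conjugacy of `n`-th powers yields two codings of one space that determine each other. -/
theorem se_core_pow_of_gconjugate [Finite G] [Fintype ι] [DecidableEq ι] [Fintype κ]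
    [DecidableEq κ] {n : ℕ} (hn : 1 ≤ n)
    (h : GConjugate G (extension A ^ n) (extension B ^ n)) : SE (core A ^ n) (core B ^ n) := by
  obtain ⟨φ, hφ, hG⟩ := h
  obtain ⟨N₁, h₁⟩ := exists_window hn hφ
  have hφ' : ∀ z, φ.symm ((extension B ^ n) z) = (extension A ^ n) (φ.symm z) := fun z => by
    apply φ.injective
    rw [hφ, φ.apply_symm_apply, φ.apply_symm_apply]
  obtain ⟨N₂, h₂⟩ := exists_window hn hφ'
  let c := extensionCoding A
  let d := (extensionCoding B).pullback φ.toEquiv hG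
  have hcd : Coding.Determines c d N₁ := fun y y' m hy => h₁ y y' m hy
  have hdc : Coding.Determines d c N₂ := fun y y' m hy => by
    have := h₂ (φ y) (φ y') m hy
    rwa [φ.symm_apply_apply, φ.symm_apply_apply] at this
  refine Coding.se_core_pow (c := c) (d := d) (N := max N₁ N₂) hn (hcd.mono (le_max_left _ _))
    (hdc.mono (le_max_right _ _)) fun k => ⟨(extension A ^ (n * k : ℤ)).toEquiv, ?_, ?_⟩
  · intro y l
    have := coord_zpow (A := A) y (n * k) l
    rw [Nat.cast_mul]
    exact this
  · intro y l
    have h3 : φ ((extension A ^ (n * k : ℤ)) y) = (extension B ^ (n * k : ℤ)) (φ y) :=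
      commute_zpow hφ k y
    have h4 := coord_zpow (A := B) (φ y) (n * k) l
    rw [← h3] at h4
    rw [Nat.cast_mul]
    exact h4

end Extension

end GSFT

theorem propositionB11 {G : Type*} [Group G] [Finite G] [TopologicalSpace G] [DiscreteTopology G] :
    -- eventual conjugacy of the `G`-SFTs is shift equivalence over `ℤ₊G`
    (∀ (n₁ n₂ : ℕ) (A : Matrix (Fin n₁) (Fin n₁) (MonoidAlgebra ℕ G))
        (B : Matrix (Fin n₂) (Fin n₂) (MonoidAlgebra ℕ G)),
      GSFT.EventuallyGConjugate G (GSFT.extension A) (GSFT.extension B) ↔ GSFT.SE A B) ∧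
    -- the characterizations of shift equivalence over `ℤ₊G`
    (∀ (n₁ n₂ : ℕ) (A : Matrix (Fin n₁) (Fin n₁) (MonoidAlgebra ℕ G))
        (B : Matrix (Fin n₂) (Fin n₂) (MonoidAlgebra ℕ G)),
      List.TFAE [
        GSFT.SE A B,
        ∃ N : ℕ, ∀ n ≥ N, GSFT.ESSE (A ^ n) (B ^ n),
        ∃ N : ℕ, ∀ n ≥ N, GSFT.SE (A ^ n) (B ^ n),
        ∃ k : ℕ, 1 ≤ k ∧ k ≡ 1 [MOD ((Nat.card G * max n₁ n₂) ^ 2).factorial] ∧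
          GSFT.SE (A ^ k) (B ^ k)]) ∧
    -- the characterizations of shift equivalence over `ℤG`
    (∀ (n₁ n₂ : ℕ) (A : Matrix (Fin n₁) (Fin n₁) (MonoidAlgebra ℤ G))
        (B : Matrix (Fin n₂) (Fin n₂) (MonoidAlgebra ℤ G)),
      List.TFAE [
        GSFT.SE A B,
        ∃ N : ℕ, ∀ n ≥ N, GSFT.ESSE (A ^ n) (B ^ n),
        ∃ N : ℕ, ∀ n ≥ N, GSFT.SE (A ^ n) (B ^ n)] ∧
      (Nat.card G * max n₁ n₂ ≠ 1 →
        (GSFT.SE A B ↔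
          ∃ k : ℕ, 1 ≤ k ∧ k ≡ 1 [MOD ((Nat.card G * max n₁ n₂) ^ 2).factorial] ∧
            GSFT.SE (A ^ k) (B ^ k)))) := by
  classical
  have := Fintype.ofFinite G
  have hcard : ∀ n₁ n₂ : ℕ, Fintype.card (Fin n₁ × G) ≤ Nat.card G * max n₁ n₂ ∧
      Fintype.card (Fin n₂ × G) ≤ Nat.card G * max n₁ n₂ := fun n₁ n₂ => by
    simp only [Fintype.card_prod, Fintype.card_fin, Nat.card_eq_fintype_card]
    rw [mul_comm n₁, mul_comm n₂]
    exact ⟨Nat.mul_le_mul_left _ (le_max_left _ _), Nat.mul_le_mul_left _ (le_max_right _ _)⟩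
  have hN : ∀ (n₁ n₂ : ℕ) (A : Matrix (Fin n₁) (Fin n₁) (MonoidAlgebra ℕ G))
        (B : Matrix (Fin n₂) (Fin n₂) (MonoidAlgebra ℕ G)),
      List.TFAE [
        GSFT.SE A B,
        ∃ N : ℕ, ∀ n ≥ N, GSFT.ESSE (A ^ n) (B ^ n),
        ∃ N : ℕ, ∀ n ≥ N, GSFT.SE (A ^ n) (B ^ n),
        ∃ k : ℕ, 1 ≤ k ∧ k ≡ 1 [MOD ((Nat.card G * max n₁ n₂) ^ 2).factorial] ∧
          GSFT.SE (A ^ k) (B ^ k)] := by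
    intro n₁ n₂ A B
    refine GSFT.tfae_SE _ fun k hk1 hk h => ?_
    obtain ⟨hA, hB⟩ := hcard n₁ n₂
    by_cases hN : Nat.card G * max n₁ n₂ = 1
    · exact GSFT.SE.of_pow_of_card_le_one (hA.trans hN.le) (hB.trans hN.le) hk1 h
    · exact GSFT.SE.of_pow_modEq (c := Nat.castRingHom ℤ) Nat.cast_injective hN hA hB hk1 hk h
  refine ⟨fun n₁ n₂ A B => ⟨fun h => ?_, fun h => ?_⟩, hN, fun n₁ n₂ A B => ?_⟩
  · obtain ⟨N, hbound⟩ := h.bddAbove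
    have hcore : GSFT.SE (GSFT.core A) (GSFT.core B) := by
      have hpow : (∃ N : ℕ, ∀ n ≥ N, GSFT.SE (GSFT.core A ^ n) (GSFT.core B ^ n)) →
          GSFT.SE (GSFT.core A) (GSFT.core B) :=
        ((hN n₁ n₂ (GSFT.core A) (GSFT.core B)).out 2 0).mp
      refine hpow ⟨N + 1, fun n hn => ?_⟩
      refine GSFT.se_core_pow_of_gconjugate (by omega) (by_contra fun hne => ?_)
      have := hbound ⟨by omega, hne⟩
      omega
    exact ((GSFT.se_core A).trans hcore).trans (GSFT.se_core B).symm
  · obtain ⟨N, hE⟩ := h.exists_forall_esse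
    refine (Set.finite_lt_nat N).subset fun n hn => ?_
    by_contra hlt
    exact hn.2 (GSFT.gconjugate_pow_of_esse hn.1 (hE n (not_lt.mp hlt)))
  · obtain ⟨hA, hB⟩ := hcard n₁ n₂
    have hZ : Function.Injective (RingHom.id ℤ) := Function.injective_id
    -- all large powers include some `k ≡ 1` to a modulus for which the size `1` is not exceptional
    have hT := GSFT.tfae_SE (A := A) (B := B) ((Nat.card G * max n₁ n₂ + 2) ^ 2)
      fun k hk1 hk h => GSFT.SE.of_pow_modEq hZ (by omega) (by omega) (by omega) hk1 hk h
    refine ⟨?_, fun hN => ?_⟩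
    · tfae_have 1 → 2 := (hT.out 0 1).mp
      tfae_have 2 → 3 := (hT.out 1 2).mp
      tfae_have 3 → 1 := (hT.out 2 0).mp
      tfae_finish
    · exact (GSFT.tfae_SE (A := A) (B := B) _ fun k hk1 hk h =>
        GSFT.SE.of_pow_modEq hZ hN hA hB hk1 hk h).out 0 3
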